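/- Let $\Bbbk$ be a field. For a $\Bbbk$-coalgebra $C$ let $C^*$ be its dual algebra with the convolution product $(fg)(x)=\sum f(x_1)g(x_2)$. A right $C$-comodule is a left $C^*$-module via $f\rightharpoonup m=\sum m_0f(m_1)$, and a left $C$-comodule is a right $C^*$-module via $m\leftharpoonup f=\sum f(m_{-1})m_0$; the modules obtained in this way are called rational. The coalgebra $C$ is: - *left (right) qcF* if $C$ embeds, as a left (right) $C^*$-module, in a free left (right) $C^*$-module; - *left (right) f-qcF* if every finite-dimensional rational left (right) $C^*$-module embeds in a free left (right) $C^*$-module; - *coFrobenius* if $C$ embeds in $C^*$ as a left or as a right $C^*$-module; - *cosemisimple* if it is the sum of its simple subcoalgebras; - *pointed* if all its simple subcoalgebras are one-dimensional; - *hereditary* if all homomorphic images of injective right (or of injective left) $C$-comodules are injective. The Gabriel quiver of a pointed coalgebra $C$ has the group-like elements of $C$ as vertices, and the number of arrows $g\to h$ is the dimension of $\{x\in C:\Delta(x)=g\otimes x+x\otimes h\}/\Bbbk(g-h)$. The path coalgebra $\Bbbk Q$ of a quiver $Q$ has the paths of $Q$ as basis, with $\Delta(p)=\sum_{xy=p}x\otimes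 y$, and $\varepsilon(p)=1$ if $p$ is trivial, $\varepsilon(p)=0$ otherwise. **Corollary.** Let $C$ be a hereditary pointed coalgebra with Gabriel quiver $Q$. The following are equivalent: 1. $C$ is left f-qcF; 2. $C$ is right f-qcF; 3. $C$ is left qcF; 4. $C$ is right qcF; 5. $C$ is coFrobenius; 6. $C$ is cosemisimple; 7. $Q$ is discrete (it has no arrows). Moreover (1)--(7) are also equivalent to each of: (5') $C$ embeds in $C^*$ as a left $C^*$-module; (5'') $C$ embeds in $C^*$ as a right $C^*$-module. All these equivalences also hold for every quiver $Q$ and every coalgebra $C$ isomorphic to the path coalgebra $\Bbbk Q$; in particular, a path coalgebra $\Bbbk Q$ is left (equivalently right) qcF if and only if $Q$ has no arrows. -/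

import Mathlib

open scoped TensorProduct

universe u u' v w

noncomputable section

namespace QcF


/-! ### Comodules and the dual algebra -/

/-- The dual algebra `C^*` of a coalgebra, with the convolution product
`(f * g)(x) = ∑ f(x₁) g(x₂)` and unit the counit. -/
abbrev DualAlg (k : Type u) (C : Type v) [Field k] [AddCommGroup C] [Module k C] :
    Type (max u v) :=
  WithConv (C →ₗ[k] k)

/-- The structure of a right `C`-comodule on the vector space `M`. -/
structure RightComodule (k : Type u) (C : Type v) (M : Type w) [Field k]
    [AddCommGroup C] [Module k C] [Coalgebra k C] [AddCommGroup M] [Module k M] where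
  coact : M →ₗ[k] M ⊗[k] C
  coassoc : ∀ m : M, TensorProduct.assoc k M C C (coact.rTensor C (coact m)) =
    (Coalgebra.comul (R := k) (A := C)).lTensor M (coact m)
  counit : ∀ m : M, (Coalgebra.counit (R := k) (A := C)).lTensor M (coact m) = m ⊗ₜ[k] (1 : k)

/-- The structure of a left `C`-comodule on the vector space `M`. -/
structure LeftComodule (k : Type u) (C : Type v) (M : Type w) [Field k]
    [AddCommGroup C] [Module k C] [Coalgebra k C] [AddCommGroup M] [Module k M] where
  coact : M →ₗ[k] C ⊗[k] M
  coassoc : ∀ m : M, TensorProduct.assoc k C C M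
      ((Coalgebra.comul (R := k) (A := C)).rTensor M (coact m)) =
    coact.lTensor C (coact m)
  counit : ∀ m : M, (Coalgebra.counit (R := k) (A := C)).rTensor M (coact m) = (1 : k) ⊗ₜ[k] m

section Modules

variable {k : Type u} {C : Type v} {M : Type w} [Field k]
  [AddCommGroup C] [Module k C] [Coalgebra k C] [AddCommGroup M] [Module k M]

/-- The action `f ⇀ m = ∑ m₀ f(m₁)` of `C^*` on a right comodule. -/
def RightComodule.act (ρ : RightComodule k C M) (f : DualAlg k C) : M →ₗ[k] M :=
  (TensorProduct.rid k M).toLinearMap ∘ₗ f.ofConv.lTensor M ∘ₗ ρ.coact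

/-- The action `m ↼ f = ∑ f(m₋₁) m₀` of `C^*` on a left comodule. -/
def LeftComodule.act (ρ : LeftComodule k C M) (f : DualAlg k C) : M →ₗ[k] M :=
  (TensorProduct.lid k M).toLinearMap ∘ₗ f.ofConv.rTensor M ∘ₗ ρ.coact

theorem RightComodule.act_mul (ρ : RightComodule k C M) (f g : DualAlg k C) (m : M) :
    ρ.act (f * g) m = ρ.act f (ρ.act g m) := by
  have key : ∀ t : M ⊗[k] C,
      ρ.act f (TensorProduct.rid k M (g.ofConv.lTensor M t)) =
      TensorProduct.rid k M ((LinearMap.mul' k k ∘ₗ TensorProduct.map f.ofConv g.ofConv).lTensor M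
        (TensorProduct.assoc k M C C (ρ.coact.rTensor C t))) := by
    intro t
    induction t with
    | zero => simp
    | add x y hx hy => simp only [map_add, hx, hy]
    | tmul n c =>
      simp only [RightComodule.act, LinearMap.lTensor_tmul, TensorProduct.rid_tmul, map_smul,
        LinearMap.comp_apply, LinearMap.rTensor_tmul, LinearEquiv.coe_coe]
      generalize ρ.coact n = s
      induction s with
      | zero => simp
      | add x y hx hy => simp only [map_add, smul_add, TensorProduct.add_tmul, hx, hy]
      | tmul a b => simp [smul_smul, mul_comm]
  have := key (ρ.coact m)
  rw [ρ.coassoc] at this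
  change _ = ρ.act f (TensorProduct.rid k M (g.ofConv.lTensor M (ρ.coact m)))
  rw [this, ← LinearMap.comp_apply (LinearMap.lTensor M _), ← LinearMap.lTensor_comp]
  rfl

theorem LeftComodule.act_mul (ρ : LeftComodule k C M) (f g : DualAlg k C) (m : M) :
    ρ.act (f * g) m = ρ.act g (ρ.act f m) := by
  have key : ∀ t : C ⊗[k] M,
      ρ.act g (TensorProduct.lid k M (f.ofConv.rTensor M t)) =
      TensorProduct.lid k M ((LinearMap.mul' k k ∘ₗ TensorProduct.map f.ofConv g.ofConv).rTensor M
        ((TensorProduct.assoc k C C M).symm (ρ.coact.lTensor C t))) := by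
    intro t
    induction t with
    | zero => simp
    | add x y hx hy => simp only [map_add, hx, hy]
    | tmul c n =>
      simp only [LeftComodule.act, LinearMap.rTensor_tmul, TensorProduct.lid_tmul, map_smul,
        LinearMap.comp_apply, LinearMap.lTensor_tmul, LinearEquiv.coe_coe]
      generalize ρ.coact n = s
      induction s with
      | zero => simp
      | add x y hx hy => simp only [map_add, smul_add, TensorProduct.tmul_add, hx, hy]
      | tmul a b => simp [smul_smul]
  have := key (ρ.coact m)
  rw [← ρ.coassoc, LinearEquiv.symm_apply_apply] at this
  change _ = ρ.act g (TensorProduct.lid k M (f.ofConv.rTensor M (ρ.coact m)))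
  rw [this, ← LinearMap.comp_apply (LinearMap.rTensor M _), ← LinearMap.rTensor_comp]
  rfl

/-- The rational left `C^*`-module attached to a right comodule. -/
abbrev RightComodule.toModule (ρ : RightComodule k C M) : Module (DualAlg k C) M where
  smul f m := ρ.act f m
  one_smul m := by
    change TensorProduct.rid k M ((Coalgebra.counit (R := k) (A := C)).lTensor M (ρ.coact m)) = m
    simp [ρ.counit]
  mul_smul := ρ.act_mul
  smul_zero f := map_zero (ρ.act f)
  smul_add f := map_add (ρ.act f)
  add_smul f g m := by
    change ρ.act (f + g) m = ρ.act f m + ρ.act g m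
    simp [RightComodule.act, LinearMap.lTensor_add]
  zero_smul m := by
    change ρ.act 0 m = 0
    simp [RightComodule.act]

/-- The rational right `C^*`-module attached to a left comodule; right modules are modules over
the opposite algebra. -/
abbrev LeftComodule.toModule (ρ : LeftComodule k C M) : Module (DualAlg k C)ᵐᵒᵖ M where
  smul f m := ρ.act f.unop m
  one_smul m := by
    change TensorProduct.lid k M ((Coalgebra.counit (R := k) (A := C)).rTensor M (ρ.coact m)) = m
    simp [ρ.counit]
  mul_smul f g m := ρ.act_mul g.unop f.unop m
  smul_zero f := map_zero (ρ.act f.unop)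
  smul_add f := map_add (ρ.act f.unop)
  add_smul f g m := by
    change ρ.act (f.unop + g.unop) m = ρ.act f.unop m + ρ.act g.unop m
    simp [LeftComodule.act, LinearMap.rTensor_add]
  zero_smul m := by
    change ρ.act 0 m = 0
    simp [LeftComodule.act]

end Modules

section Coalgebras

variable (k : Type u) (C : Type v) [Field k] [AddCommGroup C] [Module k C] [Coalgebra k C]

/-- `C` as a right comodule over itself. -/
def rightRegular : RightComodule k C C where
  coact := Coalgebra.comul
  coassoc := Coalgebra.coassoc_apply
  counit := Coalgebra.lTensor_counit_comul

/-- `C` as a left comodule over itself. -/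
def leftRegular : LeftComodule k C C where
  coact := Coalgebra.comul
  coassoc := Coalgebra.coassoc_apply
  counit := Coalgebra.rTensor_counit_comul

/-! ### Quasi-coFrobenius conditions -/

/-- The `S`-module `M` embeds in some direct sum `A^(I)` of copies of the `S`-module `A`. It is used
with `A` a ring, and `S = A` (free left `A`-modules) or `S = Aᵐᵒᵖ` (free right `A`-modules). -/
def EmbedsInFree (S : Type*) (A : Type*) (M : Type w) [Semiring S] [AddCommMonoid A]
    [Module S A] [AddCommGroup M] [Module S M] : Prop :=
  ∃ (I : Type w) (F : M →ₗ[S] (I →₀ A)), Function.Injective F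

/-- `C` embeds, as a left `C^*`-module, in a free left `C^*`-module. -/
def IsLeftQcF : Prop :=
  letI := (rightRegular k C).toModule
  EmbedsInFree (DualAlg k C) (DualAlg k C) C

/-- `C` embeds, as a right `C^*`-module, in a free right `C^*`-module. -/
def IsRightQcF : Prop :=
  letI := (leftRegular k C).toModule
  EmbedsInFree (DualAlg k C)ᵐᵒᵖ (DualAlg k C) C

/-- Every finite-dimensional rational left `C^*`-module embeds in a free left `C^*`-module. -/
def IsLeftFQcF : Prop :=
  ∀ (M : Type u) [AddCommGroup M] [Module k M] [FiniteDimensional k M]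
    (ρ : RightComodule k C M),
    letI := ρ.toModule
    EmbedsInFree (DualAlg k C) (DualAlg k C) M

/-- Every finite-dimensional rational right `C^*`-module embeds in a free right `C^*`-module. -/
def IsRightFQcF : Prop :=
  ∀ (M : Type u) [AddCommGroup M] [Module k M] [FiniteDimensional k M]
    (ρ : LeftComodule k C M),
    letI := ρ.toModule
    EmbedsInFree (DualAlg k C)ᵐᵒᵖ (DualAlg k C) M

/-- `C` embeds in `C^*` as a left `C^*`-module. -/
def IsLeftCoFrobenius : Prop :=
  letI := (rightRegular k C).toModule
  ∃ F : C →ₗ[DualAlg k C] DualAlg k C, Function.Injective F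

/-- `C` embeds in `C^*` as a right `C^*`-module. -/
def IsRightCoFrobenius : Prop :=
  letI := (leftRegular k C).toModule
  ∃ F : C →ₗ[(DualAlg k C)ᵐᵒᵖ] DualAlg k C, Function.Injective F

/-- `C` embeds in `C^*` as a left or as a right `C^*`-module. -/
def IsCoFrobenius : Prop := IsLeftCoFrobenius k C ∨ IsRightCoFrobenius k C

/-! ### Pointed, cosemisimple and hereditary coalgebras -/

variable {C} in
/-- `D` is a subcoalgebra: `Δ(D) ⊆ D ⊗ D`. -/
def IsSubcoalgebra (D : Submodule k C) : Prop :=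
  ∀ x ∈ D, Coalgebra.comul (R := k) x ∈ LinearMap.range (TensorProduct.map D.subtype D.subtype)

variable {C} in
/-- `D` is a simple subcoalgebra: nonzero, and with no subcoalgebras besides `0` and `D`. -/
def IsSimpleSubcoalgebra (D : Submodule k C) : Prop :=
  IsSubcoalgebra k D ∧ D ≠ ⊥ ∧ ∀ E : Submodule k C, IsSubcoalgebra k E → E ≤ D → E = ⊥ ∨ E = D

/-- All simple subcoalgebras are one-dimensional. -/
def IsPointed : Prop :=
  ∀ D : Submodule k C, IsSimpleSubcoalgebra k D → Module.finrank k D = 1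

/-- `C` is the sum of its simple subcoalgebras. -/
def IsCosemisimple : Prop :=
  sSup {D : Submodule k C | IsSimpleSubcoalgebra k D} = ⊤

end Coalgebras

section Hereditary

variable {k : Type u} {C : Type v} [Field k] [AddCommGroup C] [Module k C] [Coalgebra k C]

/-- Morphisms of right comodules. -/
def RightComodule.IsHom {M : Type*} {N : Type*} [AddCommGroup M] [Module k M] [AddCommGroup N]
    [Module k N] (ρ : RightComodule k C M) (σ : RightComodule k C N) (f : M →ₗ[k] N) : Prop :=
  ∀ m, σ.coact (f m) = f.rTensor C (ρ.coact m)

/-- Morphisms of left comodules. -/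
def LeftComodule.IsHom {M : Type*} {N : Type*} [AddCommGroup M] [Module k M] [AddCommGroup N]
    [Module k N] (ρ : LeftComodule k C M) (σ : LeftComodule k C N) (f : M →ₗ[k] N) : Prop :=
  ∀ m, σ.coact (f m) = f.lTensor C (ρ.coact m)

/-- Injective objects of the category of right comodules. -/
def RightComodule.IsInjective {M : Type w} [AddCommGroup M] [Module k M]
    (ρ : RightComodule k C M) : Prop :=
  ∀ (X Y : Type w) [AddCommGroup X] [Module k X] [AddCommGroup Y] [Module k Y]
    (ξ : RightComodule k C X) (η : RightComodule k C Y) (i : X →ₗ[k] Y) (f : X →ₗ[k] M),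
    ξ.IsHom η i → Function.Injective i → ξ.IsHom ρ f →
      ∃ g : Y →ₗ[k] M, η.IsHom ρ g ∧ g ∘ₗ i = f

/-- Injective objects of the category of left comodules. -/
def LeftComodule.IsInjective {M : Type w} [AddCommGroup M] [Module k M]
    (ρ : LeftComodule k C M) : Prop :=
  ∀ (X Y : Type w) [AddCommGroup X] [Module k X] [AddCommGroup Y] [Module k Y]
    (ξ : LeftComodule k C X) (η : LeftComodule k C Y) (i : X →ₗ[k] Y) (f : X →ₗ[k] M),
    ξ.IsHom η i → Function.Injective i → ξ.IsHom ρ f →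
      ∃ g : Y →ₗ[k] M, η.IsHom ρ g ∧ g ∘ₗ i = f

variable (k : Type u) (C : Type u) [Field k] [AddCommGroup C] [Module k C] [Coalgebra k C]

/-- Homomorphic images of injective right comodules are injective. -/
def IsRightHereditary : Prop :=
  ∀ (M N : Type u) [AddCommGroup M] [Module k M] [AddCommGroup N] [Module k N]
    (ρ : RightComodule k C M) (σ : RightComodule k C N) (f : M →ₗ[k] N),
    ρ.IsInjective → ρ.IsHom σ f → Function.Surjective f → σ.IsInjective

/-- Homomorphic images of injective left comodules are injective. -/
def IsLeftHereditary : Prop :=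
  ∀ (M N : Type u) [AddCommGroup M] [Module k M] [AddCommGroup N] [Module k N]
    (ρ : LeftComodule k C M) (σ : LeftComodule k C N) (f : M →ₗ[k] N),
    ρ.IsInjective → ρ.IsHom σ f → Function.Surjective f → σ.IsInjective

/-- Homomorphic images of injective right (or left) comodules are injective. -/
def IsHereditary : Prop := IsRightHereditary k C ∨ IsLeftHereditary k C

end Hereditary

/-! ### The Gabriel quiver -/

section Gabriel

variable (k : Type u) {C : Type v} [Field k] [AddCommGroup C] [Module k C] [Coalgebra k C]

/-- The space of skew-primitive elements `x`, with `Δ(x) = g ⊗ x + x ⊗ h`. -/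
def skewPrimitive (g h : C) : Submodule k C where
  carrier := {x | Coalgebra.comul (R := k) x = g ⊗ₜ[k] x + x ⊗ₜ[k] h}
  zero_mem' := by simp
  add_mem' {x y} hx hy := by
    change Coalgebra.comul (R := k) (x + y) = g ⊗ₜ[k] (x + y) + (x + y) ⊗ₜ[k] h
    rw [map_add, hx, hy, TensorProduct.tmul_add, TensorProduct.add_tmul]
    abel
  smul_mem' c x hx := by
    change Coalgebra.comul (R := k) (c • x) = g ⊗ₜ[k] (c • x) + (c • x) ⊗ₜ[k] h
    rw [map_smul, hx, smul_add, TensorProduct.tmul_smul, ← TensorProduct.smul_tmul' c x h]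

variable (C) in
/-- `V` is the Gabriel quiver of the pointed coalgebra `C`: the vertices are the group-like
elements of `C`, and the arrows `g ⟶ h` are in number the dimension of the space of
`(g, h)`-skew-primitive elements modulo the trivial ones, the multiples of `g - h`. -/
def IsGabrielQuiver (V : Type*) [Quiver V] : Prop :=
  ∃ e : V ≃ {g : C // IsGroupLikeElem k g}, ∀ a b : V,
    Nonempty (Module.Basis (a ⟶ b) k
      (skewPrimitive k (e a : C) (e b : C) ⧸
        (k ∙ ((e a : C) - (e b : C))).submoduleOf (skewPrimitive k (e a : C) (e b : C))))

end Gabriel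

/-- A quiver without arrows. -/
def IsDiscrete (V : Type*) [Quiver V] : Prop := ∀ a b : V, IsEmpty (a ⟶ b)

/-! ### Path coalgebras -/

section PathCoalgebra

variable (k : Type u) [Field k] (V : Type v) [Quiver.{w} V]

/-- All paths of a quiver, with their source and target. -/
abbrev AllPaths : Type (max v w) := Σ a b : V, Quiver.Path a b

/-- The path coalgebra `kQ`: linear combinations of paths. -/
def PathCoalgebra : Type (max u v w) := AllPaths V →₀ k

instance : AddCommGroup (PathCoalgebra k V) := inferInstanceAs (AddCommGroup (AllPaths V →₀ k))

instance : Module k (PathCoalgebra k V) := inferInstanceAs (Module k (AllPaths V →₀ k))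

variable {V}

/-- All pairs `(x, y)` of paths with `p = xy`, see `mem_splits` and `nodup_splits`. -/
def splits {a : V} : ∀ {b : V}, Quiver.Path a b → List (Σ c : V, Quiver.Path a c × Quiver.Path c b)
  | _, .nil => [⟨a, .nil, .nil⟩]
  | c, .cons p e => ⟨c, .cons p e, .nil⟩ :: (splits p).map fun s => ⟨s.1, s.2.1, .cons s.2.2 e⟩

theorem mem_splits {a b : V} (p : Quiver.Path a b)
    (s : Σ c : V, Quiver.Path a c × Quiver.Path c b) : s ∈ splits p ↔ s.2.1.comp s.2.2 = p := by
  induction p with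
  | nil =>
    obtain ⟨c, x, y⟩ := s
    cases y with
    | nil => simp [splits]
    | cons y e =>
      simp only [splits, List.mem_singleton, Quiver.Path.comp_cons]
      constructor
      · intro h
        cases h
      · intro h
        cases h
  | cons p e ih =>
    obtain ⟨c, x, y⟩ := s
    cases y with
    | nil =>
      simp only [splits, List.mem_cons, List.mem_map, Quiver.Path.comp_nil]
      constructor
      · rintro (h | ⟨t, ht, h⟩)
        · cases h
          rfl
        · cases h
      · intro h
        cases h
        exact Or.inl rfl
    | @cons d _ y e' =>
      simp only [splits, List.mem_cons, List.mem_map, Quiver.Path.comp_cons]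
      constructor
      · rintro (h | ⟨t, ht, h⟩)
        · cases h
        · cases h
          rw [(ih t).1 ht]
      · intro h
        cases h
        exact Or.inr ⟨⟨c, x, y⟩, (ih _).2 rfl, rfl⟩

theorem nodup_splits {a b : V} (p : Quiver.Path a b) : (splits p).Nodup := by
  induction p with
  | nil => simp [splits]
  | cons p e ih =>
    rw [splits, List.nodup_cons]
    refine ⟨?_, ih.map ?_⟩
    · simp only [List.mem_map, not_exists, not_and]
      rintro ⟨c, x, y⟩ _ h
      simp at h
      obtain ⟨rfl, h⟩ := h
      cases h
    · rintro ⟨c, x, y⟩ ⟨c', x', y'⟩ h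
      cases h
      rfl

/-- The basis element of the path coalgebra given by a path. -/
def ofPath {a b : V} (p : Quiver.Path a b) : PathCoalgebra k V :=
  Finsupp.single (⟨a, b, p⟩ : AllPaths V) (1 : k)

/-- `Δ(p) = ∑ x ⊗ y`, over all pairs of paths with `xy = p`. -/
def pathComul : PathCoalgebra k V →ₗ[k] PathCoalgebra k V ⊗[k] PathCoalgebra k V :=
  Finsupp.linearCombination k fun p : AllPaths V =>
    ((splits p.2.2).map fun s => ofPath k s.2.1 ⊗ₜ[k] ofPath k s.2.2).sum

/-- `ε(p) = 1` for trivial paths, `ε(p) = 0` for all other paths. -/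
def pathCounit : PathCoalgebra k V →ₗ[k] k :=
  Finsupp.linearCombination k fun p : AllPaths V => if p.2.2.length = 0 then (1 : k) else 0

theorem pathComul_ofPath {a b : V} (p : Quiver.Path a b) : pathComul k (ofPath k p) =
    ((splits p).map fun s => ofPath k s.2.1 ⊗ₜ[k] ofPath k s.2.2).sum := by
  rw [pathComul, ofPath]
  exact (Finsupp.linearCombination_single k _ _).trans (one_smul k _)

theorem pathCounit_ofPath {a b : V} (p : Quiver.Path a b) : pathCounit k (ofPath k p) =
    if p.length = 0 then (1 : k) else 0 := by
  rw [pathCounit, ofPath]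
  exact (Finsupp.linearCombination_single k _ _).trans (one_smul k _)

theorem path_hom_ext {N : Type*} [AddCommGroup N] [Module k N] {f g : PathCoalgebra k V →ₗ[k] N}
    (h : ∀ (a b : V) (p : Quiver.Path a b), f (ofPath k p) = g (ofPath k p)) : f = g :=
  Finsupp.lhom_ext' fun p => LinearMap.ext_ring (h p.1 p.2.1 p.2.2)

theorem splits_coassoc {N : Type*} [AddCommGroup N] {a b : V} (p : Quiver.Path a b)
    (F : ∀ c d : V, Quiver.Path a c → Quiver.Path c d → Quiver.Path d b → N) :
    ((splits p).map fun s => ((splits s.2.1).map fun t => F t.1 s.1 t.2.1 t.2.2 s.2.2).sum).sum =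
    ((splits p).map fun s => ((splits s.2.2).map fun t => F s.1 t.1 s.2.1 t.2.1 t.2.2).sum).sum := by
  induction p with
  | nil => simp [splits]
  | cons p e ih =>
    have := ih fun c d x y z => F c d x y (z.cons e)
    simp only [splits, List.map_cons, List.sum_cons, List.map_map, Function.comp_def,
      List.map_nil, List.sum_nil, List.sum_map_add, add_zero] at this ⊢
    rw [this, add_assoc]

theorem splits_counit_left {N : Type*} [AddCommGroup N] [Module k N] {a b : V}
    (p : Quiver.Path a b) (G : ∀ c : V, Quiver.Path c b → N) :
    ((splits p).map fun s => (if s.2.1.length = 0 then (1 : k) else 0) • G s.1 s.2.2).sum =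
      G a p := by
  induction p with
  | nil => simp [splits]
  | cons p e ih =>
    have := ih fun c y => G c (y.cons e)
    simpa [splits, Function.comp_def] using this

theorem splits_counit_right {N : Type*} [AddCommGroup N] [Module k N] {a b : V}
    (p : Quiver.Path a b) (G : ∀ c : V, Quiver.Path a c → N) :
    ((splits p).map fun s => (if s.2.2.length = 0 then (1 : k) else 0) • G s.1 s.2.1).sum =
      G b p := by
  cases p with
  | nil => simp [splits]
  | cons p e => simp [splits, Function.comp_def]

instance : Coalgebra k (PathCoalgebra k V) where
  comul := pathComul k
  counit := pathCounit k
  coassoc := by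
    refine path_hom_ext k fun a b p => ?_
    simp only [LinearMap.comp_apply, LinearEquiv.coe_coe, pathComul_ofPath, map_list_sum,
      List.map_map, Function.comp_def, LinearMap.rTensor_tmul, LinearMap.lTensor_tmul]
    have := splits_coassoc p fun _ _ x y z =>
      ofPath k x ⊗ₜ[k] (ofPath k y ⊗ₜ[k] ofPath k z)
    have h1 : ∀ {c d : V} (x : Quiver.Path c d) (z : PathCoalgebra k V),
        TensorProduct.assoc k _ _ _ (((splits x).map fun s =>
          ofPath k s.2.1 ⊗ₜ[k] ofPath k s.2.2).sum ⊗ₜ[k] z) =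
        ((splits x).map fun s => ofPath k s.2.1 ⊗ₜ[k] (ofPath k s.2.2 ⊗ₜ[k] z)).sum := by
      intro c d x z
      induction splits x with
      | nil => simp
      | cons s l ih => simp [TensorProduct.add_tmul, ih]
    have h2 : ∀ {c d : V} (x : Quiver.Path c d) (z : PathCoalgebra k V),
        z ⊗ₜ[k] ((splits x).map fun s => ofPath k s.2.1 ⊗ₜ[k] ofPath k s.2.2).sum =
        ((splits x).map fun s => z ⊗ₜ[k] (ofPath k s.2.1 ⊗ₜ[k] ofPath k s.2.2)).sum := by
      intro c d x z
      induction splits x with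
      | nil => simp
      | cons s l ih => simp [TensorProduct.tmul_add, ih]
    simp only [h1, h2]
    exact this
  rTensor_counit_comp_comul := by
    refine path_hom_ext k fun a b p => ?_
    simp only [LinearMap.comp_apply, pathComul_ofPath, map_list_sum,
      List.map_map, Function.comp_def, LinearMap.rTensor_tmul, pathCounit_ofPath,
      TensorProduct.mk_apply]
    have := splits_counit_left k p fun _ y => (1 : k) ⊗ₜ[k] ofPath k y
    simpa only [TensorProduct.smul_tmul', smul_eq_mul, mul_one] using this
  lTensor_counit_comp_comul := by
    refine path_hom_ext k fun a b p => ?_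
    simp only [LinearMap.comp_apply, pathComul_ofPath, map_list_sum,
      List.map_map, Function.comp_def, LinearMap.lTensor_tmul, pathCounit_ofPath,
      LinearMap.flip_apply, TensorProduct.mk_apply]
    have := splits_counit_right k p fun _ x => ofPath k x ⊗ₜ[k] (1 : k)
    simpa only [← TensorProduct.tmul_smul, smul_eq_mul, mul_one] using this

end PathCoalgebra

end QcF

end

namespace QcF

/-! ### Functionals on tensor products and the regular actions -/

section Separation

variable {k : Type u} [Field k] {M : Type*} {N : Type*} [AddCommGroup M] [Module k M]
  [AddCommGroup N] [Module k N]

/-! The link between the module conditions and the quiver is an eigenvector in `C^*`. If `C` is left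
f-qcF and `h` is group-like, the one-dimensional comodule of `h` embeds in a free module, and a
nonzero coordinate of its generator is some `φ ≠ 0` with `f * φ = f h • φ` for all `f`.

Suppose now that `x` is `(g, h)`-skew-primitive and not a multiple of `g - h`. Some functional `ξ`
kills `g` and `h` but not `x`, and then `ξ * φ = 0`. Hereditariness makes cyclic ideals of `C^*` on
one side projective: translating `C` by `ψ` has as image a quotient of the injective comodule `C`,
hence a direct summand, and the projection onto it is translation by some `e`. On the right
hereditary side, `ψ * e = ψ` and `e` is killed on the right by whatever kills `ψ`
(`IsRightHereditary.exists_mul_eq`); the left hereditary side is the mirror image. Applied to `ξ` or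
to `φ`, and evaluated at `x` through `(f₁ * f₂) x = f₁ g * f₂ x + f₁ x * f₂ h`, this forces `ξ x =
0`, a contradiction. Right f-qcF is symmetric, with the eigenvector taken at `g`.

Conversely, a pointed coalgebra without nontrivial skew-primitives is spanned by group-likes
(`IsPointed.groupLikeSpan_eq_top_of_skewPrimitive`): otherwise the quotient by that span has a
one-dimensional subcomodule, and a lift `x` of its generator satisfies `Δ x = x ⊗ h + ∑ g ⊗ y_g`
with every `y_g` skew-primitive, which puts `x` back in the span. Group-likes are linearly
independent, so they then form a basis, and sending each to its dual functional embeds `C` in `C^*`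
on both sides. The passage from qcF to f-qcF uses that coefficient maps separate the points of a
comodule.

For a path coalgebra the eigenvector `φ` is tested directly on paths: an arrow makes it vanish
everywhere. Neither hereditariness nor the Gabriel quiver of `kQ` is needed. -/

theorem eq_of_lTensor_eq {s t : M ⊗[k] N}
    (h : ∀ f : N →ₗ[k] k, TensorProduct.rid k M (f.lTensor M s) =
      TensorProduct.rid k M (f.lTensor M t)) : s = t := by
  classical
  let b := Module.Basis.ofVectorSpace k N
  have key : ∀ (z : M ⊗[k] N) i, TensorProduct.equivFinsuppOfBasisRight b z i =
      TensorProduct.rid k M ((b.coord i).lTensor M z) := by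
    intro z i
    induction z with
    | zero => simp
    | add x y hx hy => simp [hx, hy]
    | tmul x y => simp
  apply (TensorProduct.equivFinsuppOfBasisRight b).injective
  ext i
  rw [key, key, h]

theorem eq_of_rTensor_eq {s t : M ⊗[k] N}
    (h : ∀ f : M →ₗ[k] k, TensorProduct.lid k N (f.rTensor N s) =
      TensorProduct.lid k N (f.rTensor N t)) : s = t := by
  classical
  let b := Module.Basis.ofVectorSpace k M
  have key : ∀ (z : M ⊗[k] N) i, TensorProduct.equivFinsuppOfBasisLeft b z i =
      TensorProduct.lid k N ((b.coord i).rTensor N z) := by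
    intro z i
    induction z with
    | zero => simp
    | add x y hx hy => simp [hx, hy]
    | tmul x y => simp
  apply (TensorProduct.equivFinsuppOfBasisLeft b).injective
  ext i
  rw [key, key, h]

/-- A tensor is a finite sum of pure tensors, whose first legs span `P`. This is the source of all
local finiteness below. -/
theorem exists_finite_lTensor_mem (t : M ⊗[k] N) : ∃ P : Submodule k M, FiniteDimensional k P ∧
    ∀ f : N →ₗ[k] k, TensorProduct.rid k M (f.lTensor M t) ∈ P := by
  induction t with
  | zero => exact ⟨⊥, inferInstance, by simp⟩
  | tmul x y =>
    exact ⟨k ∙ x, inferInstance, fun f => by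
      simpa using (k ∙ x).smul_mem (f y) (Submodule.mem_span_singleton_self x)⟩
  | add x y hx hy =>
    obtain ⟨P, _, hP⟩ := hx
    obtain ⟨Q, _, hQ⟩ := hy
    exact ⟨P ⊔ Q, inferInstance, fun f => by
      simpa using add_mem (Submodule.mem_sup_left (hP f)) (Submodule.mem_sup_right (hQ f))⟩

theorem exists_finite_rTensor_mem (t : M ⊗[k] N) : ∃ P : Submodule k N, FiniteDimensional k P ∧
    ∀ f : M →ₗ[k] k, TensorProduct.lid k N (f.rTensor N t) ∈ P := by
  induction t with
  | zero => exact ⟨⊥, inferInstance, by simp⟩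
  | tmul x y =>
    exact ⟨k ∙ y, inferInstance, fun f => by
      simpa using (k ∙ y).smul_mem (f x) (Submodule.mem_span_singleton_self y)⟩
  | add x y hx hy =>
    obtain ⟨P, _, hP⟩ := hx
    obtain ⟨Q, _, hQ⟩ := hy
    exact ⟨P ⊔ Q, inferInstance, fun f => by
      simpa using add_mem (Submodule.mem_sup_left (hP f)) (Submodule.mem_sup_right (hQ f))⟩

/-- Linear projections `p` onto `D` and `q` onto `E` each fix `t` in their own leg, so `t` is its
own image under `p ⊗ q`. -/
theorem mem_range_map_subtype {D : Submodule k M} {E : Submodule k N} {t : M ⊗[k] N}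
    (hD : ∀ f : N →ₗ[k] k, TensorProduct.rid k M (f.lTensor M t) ∈ D)
    (hE : ∀ f : M →ₗ[k] k, TensorProduct.lid k N (f.rTensor N t) ∈ E) :
    t ∈ LinearMap.range (TensorProduct.map D.subtype E.subtype) := by
  obtain ⟨p, hp⟩ := D.subtype.exists_leftInverse_of_injective (by simp)
  obtain ⟨q, hq⟩ := E.subtype.exists_leftInverse_of_injective (by simp)
  have hp' : ∀ x ∈ D, (p x : M) = x := fun x hx =>
    congrArg Subtype.val (LinearMap.congr_fun hp ⟨x, hx⟩)
  have hq' : ∀ x ∈ E, (q x : N) = x := fun x hx =>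
    congrArg Subtype.val (LinearMap.congr_fun hq ⟨x, hx⟩)
  have h1 : (D.subtype ∘ₗ p).rTensor N t = t := by
    refine eq_of_lTensor_eq fun f => ?_
    rw [← hp' _ (hD f)]
    generalize t = z
    induction z with
    | zero => simp
    | add x y hx hy => simp [hx, hy]
    | tmul x y => simp
  have h2 : (E.subtype ∘ₗ q).lTensor M t = t := by
    refine eq_of_rTensor_eq fun f => ?_
    rw [← hq' _ (hE f)]
    generalize t = z
    induction z with
    | zero => simp
    | add x y hx hy => simp [hx, hy]
    | tmul x y => simp
  refine ⟨TensorProduct.map p q t, ?_⟩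
  conv_rhs => rw [← h1, ← h2]
  rw [← LinearMap.comp_apply, ← TensorProduct.map_comp, ← LinearMap.comp_apply,
    LinearMap.rTensor_comp_lTensor]

theorem module_dual_ext {x y : M} (h : ∀ f : M →ₗ[k] k, f x = f y) : x = y := by
  refine sub_eq_zero.1 ((Module.forall_dual_apply_eq_zero_iff k _).1 fun f => ?_)
  rw [map_sub, sub_eq_zero]
  exact h f

theorem dual_ext {x y : M} (h : ∀ f : DualAlg k M, f x = f y) : x = y :=
  module_dual_ext fun f => h (WithConv.toConv f)

end Separation

/-! ### Coefficient maps, convolution actions and injectivity of the regular comodules -/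

section Action

variable {k : Type u} {C : Type v} {M : Type w} [Field k]
  [AddCommGroup C] [Module k C] [Coalgebra k C] [AddCommGroup M] [Module k M]

/-- The coefficient `∑ μ(m₀) m₁`. -/
def RightComodule.coeff (ρ : RightComodule k C M) (μ : M →ₗ[k] k) : M →ₗ[k] C :=
  (TensorProduct.lid k C).toLinearMap ∘ₗ μ.rTensor C ∘ₗ ρ.coact

/-- The coefficient `∑ m₋₁ μ(m₀)`. -/
def LeftComodule.coeff (ρ : LeftComodule k C M) (μ : M →ₗ[k] k) : M →ₗ[k] C :=
  (TensorProduct.rid k C).toLinearMap ∘ₗ μ.lTensor C ∘ₗ ρ.coact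

/-- Since functionals separate points, this adjunction turns identities about coefficients and
translations in `C` into identities in `C^*`. -/
theorem RightComodule.apply_coeff (ρ : RightComodule k C M) (μ : M →ₗ[k] k) (f : DualAlg k C)
    (m : M) : f (ρ.coeff μ m) = μ (ρ.act f m) := by
  simp only [coeff, act, LinearMap.comp_apply]
  generalize ρ.coact m = t
  induction t with
  | zero => simp
  | add x y hx hy => simp only [map_add, hx, hy]
  | tmul x y => simp [mul_comm]

theorem LeftComodule.apply_coeff (ρ : LeftComodule k C M) (μ : M →ₗ[k] k) (f : DualAlg k C)
    (m : M) : f (ρ.coeff μ m) = μ (ρ.act f m) := by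
  simp only [coeff, act, LinearMap.comp_apply]
  generalize ρ.coact m = t
  induction t with
  | zero => simp
  | add x y hx hy => simp only [map_add, hx, hy]
  | tmul x y => simp [mul_comm]

theorem mul_apply_eq_apply_right (f g : DualAlg k C) (c : C) :
    (f * g) c = f ((rightRegular k C).act g c) := by
  simp only [RightComodule.act, LinearMap.comp_apply, LinearMap.convMul_apply, rightRegular]
  generalize Coalgebra.comul (R := k) c = t
  induction t with
  | zero => simp
  | add x y hx hy => simp only [map_add, hx, hy]
  | tmul x y => simp [mul_comm]

theorem mul_apply_eq_apply_left (f g : DualAlg k C) (c : C) :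
    (f * g) c = g ((leftRegular k C).act f c) := by
  simp only [LeftComodule.act, LinearMap.comp_apply, LinearMap.convMul_apply, leftRegular]
  generalize Coalgebra.comul (R := k) c = t
  induction t with
  | zero => simp
  | add x y hx hy => simp only [map_add, hx, hy]
  | tmul x y => simp

theorem RightComodule.coeff_act (ρ : RightComodule k C M) (μ : M →ₗ[k] k) (f : DualAlg k C)
    (m : M) : ρ.coeff μ (ρ.act f m) = (rightRegular k C).act f (ρ.coeff μ m) :=
  dual_ext fun g => by
    rw [apply_coeff, ← act_mul, ← mul_apply_eq_apply_right, apply_coeff]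

theorem LeftComodule.coeff_act (ρ : LeftComodule k C M) (μ : M →ₗ[k] k) (f : DualAlg k C)
    (m : M) : ρ.coeff μ (ρ.act f m) = (leftRegular k C).act f (ρ.coeff μ m) :=
  dual_ext fun g => by
    rw [apply_coeff, ← act_mul, ← mul_apply_eq_apply_left, apply_coeff]

/-- The translation on the other side is absorbed into the functional `μ`. Together with `coeff_act`
it makes the space of all coefficients stable on both sides, hence a subcoalgebra. -/
theorem RightComodule.coeff_comp_act (ρ : RightComodule k C M) (μ : M →ₗ[k] k)
    (f : DualAlg k C) (m : M) :
    ρ.coeff (μ ∘ₗ ρ.act f) m = (leftRegular k C).act f (ρ.coeff μ m) :=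
  dual_ext fun g => by
    rw [apply_coeff, ← mul_apply_eq_apply_left, apply_coeff, act_mul, LinearMap.comp_apply]

theorem RightComodule.act_one (ρ : RightComodule k C M) (m : M) : ρ.act 1 m = m := by
  let := ρ.toModule
  exact one_smul (DualAlg k C) m

theorem LeftComodule.act_one (ρ : LeftComodule k C M) (m : M) : ρ.act 1 m = m := by
  let := ρ.toModule
  exact one_smul (DualAlg k C)ᵐᵒᵖ m

theorem RightComodule.act_smul (ρ : RightComodule k C M) (a : k) (f : DualAlg k C) (m : M) :
    ρ.act (a • f) m = a • ρ.act f m := by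
  simp [act, LinearMap.lTensor_smul]

theorem LeftComodule.act_smul (ρ : LeftComodule k C M) (a : k) (f : DualAlg k C) (m : M) :
    ρ.act (a • f) m = a • ρ.act f m := by
  simp [act, LinearMap.rTensor_smul]

theorem RightComodule.counit_coeff (ρ : RightComodule k C M) (μ : M →ₗ[k] k) (m : M) :
    Coalgebra.counit (R := k) (ρ.coeff μ m) = μ m := by
  simpa [act_one] using ρ.apply_coeff μ 1 m

theorem LeftComodule.counit_coeff (ρ : LeftComodule k C M) (μ : M →ₗ[k] k) (m : M) :
    Coalgebra.counit (R := k) (ρ.coeff μ m) = μ m := by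
  simpa [act_one] using ρ.apply_coeff μ 1 m

/-- This is coassociativity: left translation by `g` is the coefficient map of the right regular
comodule at the functional `g`. -/
theorem act_comm (f g : DualAlg k C) (c : C) :
    (leftRegular k C).act g ((rightRegular k C).act f c) =
      (rightRegular k C).act f ((leftRegular k C).act g c) :=
  (rightRegular k C).coeff_act g.ofConv f c

theorem counit_act_right (f : DualAlg k C) (c : C) :
    Coalgebra.counit (R := k) ((rightRegular k C).act f c) = f c := by
  simpa using (mul_apply_eq_apply_right 1 f c).symm

theorem counit_act_left (f : DualAlg k C) (c : C) :
    Coalgebra.counit (R := k) ((leftRegular k C).act f c) = f c := by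
  simpa using (mul_apply_eq_apply_left f 1 c).symm

theorem RightComodule.IsHom.act {N : Type*} [AddCommGroup N] [Module k N]
    {ρ : RightComodule k C M} {σ : RightComodule k C N} {p : M →ₗ[k] N} (h : ρ.IsHom σ p)
    (f : DualAlg k C) (m : M) : p (ρ.act f m) = σ.act f (p m) := by
  simp only [RightComodule.act, LinearMap.comp_apply, h m]
  generalize ρ.coact m = t
  induction t with
  | zero => simp
  | add x y hx hy => simp only [map_add, hx, hy]
  | tmul x y => simp

theorem LeftComodule.IsHom.act {N : Type*} [AddCommGroup N] [Module k N]
    {ρ : LeftComodule k C M} {σ : LeftComodule k C N} {p : M →ₗ[k] N} (h : ρ.IsHom σ p)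
    (f : DualAlg k C) (m : M) : p (ρ.act f m) = σ.act f (p m) := by
  simp only [LeftComodule.act, LinearMap.comp_apply, h m]
  generalize ρ.coact m = t
  induction t with
  | zero => simp
  | add x y hx hy => simp only [map_add, hx, hy]
  | tmul x y => simp

theorem RightComodule.isHom_of_act {N : Type*} [AddCommGroup N] [Module k N]
    {ρ : RightComodule k C M} {σ : RightComodule k C N} {p : M →ₗ[k] N}
    (h : ∀ (f : DualAlg k C) (m : M), p (ρ.act f m) = σ.act f (p m)) : ρ.IsHom σ p := by
  refine fun m => eq_of_lTensor_eq fun f => ?_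
  refine (h (WithConv.toConv f) m).symm.trans ?_
  simp only [RightComodule.act, LinearMap.comp_apply]
  generalize ρ.coact m = t
  induction t with
  | zero => simp
  | add x y hx hy => simp only [map_add, hx, hy]
  | tmul x y => simp

theorem LeftComodule.isHom_of_act {N : Type*} [AddCommGroup N] [Module k N]
    {ρ : LeftComodule k C M} {σ : LeftComodule k C N} {p : M →ₗ[k] N}
    (h : ∀ (f : DualAlg k C) (m : M), p (ρ.act f m) = σ.act f (p m)) : ρ.IsHom σ p := by
  refine fun m => eq_of_rTensor_eq fun f => ?_
  refine (h (WithConv.toConv f) m).symm.trans ?_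
  simp only [LeftComodule.act, LinearMap.comp_apply]
  generalize ρ.coact m = t
  induction t with
  | zero => simp
  | add x y hx hy => simp only [map_add, hx, hy]
  | tmul x y => simp

/-- The quotient comodule of a right comodule by a stable subspace. -/
theorem RightComodule.exists_isHom_of_surjective {N : Type*} [AddCommGroup N] [Module k N]
    (ρ : RightComodule k C M) {p : M →ₗ[k] N} (hp : Function.Surjective p)
    (h : ∀ m, p m = 0 → ∀ f : DualAlg k C, p (ρ.act f m) = 0) :
    ∃ σ : RightComodule k C N, ρ.IsHom σ p := by
  obtain ⟨s, hs⟩ := p.exists_rightInverse_of_surjective (LinearMap.range_eq_top.2 hp)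
  have hker : ∀ m, p m = 0 → p.rTensor C (ρ.coact m) = 0 := by
    intro m hm
    refine eq_of_lTensor_eq fun f => ?_
    rw [map_zero, map_zero, ← h m hm (WithConv.toConv f)]
    simp only [act, LinearMap.comp_apply]
    generalize ρ.coact m = t
    induction t with
    | zero => simp
    | add x y hx hy => simp only [map_add, hx, hy]
    | tmul x y => simp
  -- A merely linear section suffices, because `hker` makes the value independent of the lift.
  let γ : N →ₗ[k] N ⊗[k] C := p.rTensor C ∘ₗ ρ.coact ∘ₗ s
  have hγ : ∀ m, γ (p m) = p.rTensor C (ρ.coact m) := by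
    intro m
    have : p (s (p m)) = p m := LinearMap.congr_fun hs (p m)
    rw [← sub_eq_zero]
    simpa [γ] using hker (s (p m) - m) (by simp [this])
  have hγ' : γ ∘ₗ p = p.rTensor C ∘ₗ ρ.coact := LinearMap.ext hγ
  refine ⟨⟨γ, fun n => ?_, fun n => ?_⟩, hγ⟩
  · obtain ⟨m, rfl⟩ := hp n
    have h1 : ∀ t : (M ⊗[k] C) ⊗[k] C, TensorProduct.assoc k N C C ((p.rTensor C).rTensor C t) =
        p.rTensor (C ⊗[k] C) (TensorProduct.assoc k M C C t) := by
      intro t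
      exact LinearMap.congr_fun (TensorProduct.ext_threefold
        (g := (TensorProduct.assoc k N C C).toLinearMap ∘ₗ (p.rTensor C).rTensor C)
        (h := p.rTensor (C ⊗[k] C) ∘ₗ (TensorProduct.assoc k M C C).toLinearMap) (by simp)) t
    rw [hγ, ← LinearMap.comp_apply, ← LinearMap.rTensor_comp, hγ', LinearMap.rTensor_comp,
      LinearMap.comp_apply, h1, ρ.coassoc]
    generalize ρ.coact m = t
    induction t with
    | zero => simp
    | add x y hx hy => simp only [map_add, hx, hy]
    | tmul x y => simp
  · obtain ⟨m, rfl⟩ := hp n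
    rw [hγ, ← LinearMap.comp_apply, LinearMap.lTensor_comp_rTensor,
      ← LinearMap.rTensor_comp_lTensor, LinearMap.comp_apply, ρ.counit, LinearMap.rTensor_tmul]

/-- The quotient comodule of a left comodule by a stable subspace. -/
theorem LeftComodule.exists_isHom_of_surjective {N : Type*} [AddCommGroup N] [Module k N]
    (ρ : LeftComodule k C M) {p : M →ₗ[k] N} (hp : Function.Surjective p)
    (h : ∀ m, p m = 0 → ∀ f : DualAlg k C, p (ρ.act f m) = 0) :
    ∃ σ : LeftComodule k C N, ρ.IsHom σ p := by
  obtain ⟨s, hs⟩ := p.exists_rightInverse_of_surjective (LinearMap.range_eq_top.2 hp)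
  have hker : ∀ m, p m = 0 → p.lTensor C (ρ.coact m) = 0 := by
    intro m hm
    refine eq_of_rTensor_eq fun f => ?_
    rw [map_zero, map_zero, ← h m hm (WithConv.toConv f)]
    simp only [act, LinearMap.comp_apply]
    generalize ρ.coact m = t
    induction t with
    | zero => simp
    | add x y hx hy => simp only [map_add, hx, hy]
    | tmul x y => simp
  let γ : N →ₗ[k] C ⊗[k] N := p.lTensor C ∘ₗ ρ.coact ∘ₗ s
  have hγ : ∀ m, γ (p m) = p.lTensor C (ρ.coact m) := by
    intro m
    have : p (s (p m)) = p m := LinearMap.congr_fun hs (p m)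
    rw [← sub_eq_zero]
    simpa [γ] using hker (s (p m) - m) (by simp [this])
  have hγ' : γ ∘ₗ p = p.lTensor C ∘ₗ ρ.coact := LinearMap.ext hγ
  refine ⟨⟨γ, fun n => ?_, fun n => ?_⟩, hγ⟩
  · obtain ⟨m, rfl⟩ := hp n
    have h1 : ∀ t : (C ⊗[k] C) ⊗[k] M, TensorProduct.assoc k C C N (p.lTensor (C ⊗[k] C) t) =
        (p.lTensor C).lTensor C (TensorProduct.assoc k C C M t) := by
      intro t
      exact LinearMap.congr_fun (TensorProduct.ext_threefold
        (g := (TensorProduct.assoc k C C N).toLinearMap ∘ₗ p.lTensor (C ⊗[k] C))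
        (h := (p.lTensor C).lTensor C ∘ₗ (TensorProduct.assoc k C C M).toLinearMap) (by simp)) t
    rw [hγ, ← LinearMap.comp_apply (LinearMap.lTensor C γ), ← LinearMap.lTensor_comp, hγ',
      LinearMap.lTensor_comp, LinearMap.comp_apply, ← ρ.coassoc, ← h1]
    generalize ρ.coact m = t
    induction t with
    | zero => simp
    | add x y hx hy => simp only [map_add, hx, hy]
    | tmul x y => simp
  · obtain ⟨m, rfl⟩ := hp n
    rw [hγ, ← LinearMap.comp_apply, LinearMap.rTensor_comp_lTensor,
      ← LinearMap.lTensor_comp_rTensor, LinearMap.comp_apply, ρ.counit, LinearMap.lTensor_tmul]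

/-- Right comodule maps to `C` correspond to linear functionals. -/
theorem isHom_coeff_right (ρ : RightComodule k C M) (μ : M →ₗ[k] k) :
    ρ.IsHom (rightRegular k C) (ρ.coeff μ) :=
  RightComodule.isHom_of_act fun f m => ρ.coeff_act μ f m

theorem isHom_coeff_left (ρ : LeftComodule k C M) (μ : M →ₗ[k] k) :
    ρ.IsHom (leftRegular k C) (ρ.coeff μ) :=
  LeftComodule.isHom_of_act fun f m => ρ.coeff_act μ f m

theorem RightComodule.IsHom.eq_coeff {ρ : RightComodule k C M} {p : M →ₗ[k] C}
    (h : ρ.IsHom (rightRegular k C) p) : p = ρ.coeff (Coalgebra.counit (R := k) ∘ₗ p) :=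
  LinearMap.ext fun m => dual_ext fun f => by
    rw [apply_coeff, LinearMap.comp_apply, h.act, counit_act_right]

theorem LeftComodule.IsHom.eq_coeff {ρ : LeftComodule k C M} {p : M →ₗ[k] C}
    (h : ρ.IsHom (leftRegular k C) p) : p = ρ.coeff (Coalgebra.counit (R := k) ∘ₗ p) :=
  LinearMap.ext fun m => dual_ext fun f => by
    rw [apply_coeff, LinearMap.comp_apply, h.act, counit_act_left]

/-- Comodule maps into `C` are the same as linear functionals, by composing with the counit, and
functionals extend along any injective linear map. -/
theorem isInjective_rightRegular : (rightRegular k C).IsInjective := by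
  intro X Y _ _ _ _ ξ η i f hi hinj hf
  obtain ⟨r, hr⟩ := i.exists_leftInverse_of_injective (LinearMap.ker_eq_bot.2 hinj)
  refine ⟨η.coeff (Coalgebra.counit ∘ₗ f ∘ₗ r), isHom_coeff_right _ _, ?_⟩
  refine LinearMap.ext fun x => dual_ext fun g : DualAlg k C => ?_
  have h : r (i (ξ.act g x)) = ξ.act g x := LinearMap.congr_fun hr _
  rw [LinearMap.comp_apply, RightComodule.apply_coeff, ← hi.act, LinearMap.comp_apply,
    LinearMap.comp_apply, h, hf.act, counit_act_right]

theorem isInjective_leftRegular : (leftRegular k C).IsInjective := by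
  intro X Y _ _ _ _ ξ η i f hi hinj hf
  obtain ⟨r, hr⟩ := i.exists_leftInverse_of_injective (LinearMap.ker_eq_bot.2 hinj)
  refine ⟨η.coeff (Coalgebra.counit ∘ₗ f ∘ₗ r), isHom_coeff_left _ _, ?_⟩
  refine LinearMap.ext fun x => dual_ext fun g : DualAlg k C => ?_
  have h : r (i (ξ.act g x)) = ξ.act g x := LinearMap.congr_fun hr _
  rw [LinearMap.comp_apply, LeftComodule.apply_coeff, ← hi.act, LinearMap.comp_apply,
    LinearMap.comp_apply, h, hf.act, counit_act_left]

end Action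

/-! ### Annihilators in the dual algebra of a hereditary coalgebra -/

section Hereditary

variable {k : Type u} {C : Type u} [Field k] [AddCommGroup C] [Module k C] [Coalgebra k C]

/-- Principal right ideals of the dual algebra of a right hereditary coalgebra are projective. -/
theorem IsRightHereditary.exists_mul_eq (H : IsRightHereditary k C) (ψ : DualAlg k C) :
    ∃ e : DualAlg k C, ψ * e = ψ ∧ ∀ f : DualAlg k C, ψ * f = 0 → e * f = 0 := by
  -- Since `(ψ * f) c = f (R c)`, the ideal `ψ * C^*` is the dual of the image of `R`.
  let R : C →ₗ[k] C := (leftRegular k C).act ψ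
  have hR : ∀ (f : DualAlg k C) (c : C),
      R ((rightRegular k C).act f c) = (rightRegular k C).act f (R c) := fun f c => act_comm f ψ c
  have hsurj := R.surjective_rangeRestrict
  obtain ⟨σ, hσ⟩ := (rightRegular k C).exists_isHom_of_surjective hsurj (by
    intro m hm f
    have hm' : R m = 0 := congrArg Subtype.val hm
    exact Subtype.ext ((hR f m).trans (by rw [hm', map_zero]; rfl)))
  have hinj := H C (LinearMap.range R) _ σ R.rangeRestrict isInjective_rightRegular hσ hsurj
  have hι : σ.IsHom (rightRegular k C) (LinearMap.range R).subtype := by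
    refine RightComodule.isHom_of_act fun f n => ?_
    obtain ⟨c, rfl⟩ := hsurj n
    rw [← hσ.act]
    exact hR f c
  -- Injectivity of the image splits its inclusion in `C`. The resulting idempotent endomorphism of
  -- the right comodule `C` is left translation by its composite with the counit, which is `e`.
  obtain ⟨r, hr, hrι⟩ := hinj _ _ σ (rightRegular k C) (LinearMap.range R).subtype LinearMap.id hι
    Subtype.val_injective (fun m => by simp)
  have hιr : (rightRegular k C).IsHom (rightRegular k C) ((LinearMap.range R).subtype ∘ₗ r) :=
    RightComodule.isHom_of_act fun f c => by
      rw [LinearMap.comp_apply, LinearMap.comp_apply, hr.act, hι.act]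
  let e : DualAlg k C := WithConv.toConv (Coalgebra.counit ∘ₗ (LinearMap.range R).subtype ∘ₗ r)
  have he : ∀ c, (leftRegular k C).act e c = (r c : C) := fun c =>
    (LinearMap.congr_fun hιr.eq_coeff c).symm
  refine ⟨e, WithConv.ext (LinearMap.ext fun c => ?_),
    fun f hf => WithConv.ext (LinearMap.ext fun c => ?_)⟩
  · refine (mul_apply_eq_apply_left ψ e c).trans ?_
    change Coalgebra.counit (R := k) (r (R.rangeRestrict c) : C) = _
    have : r (R.rangeRestrict c) = R.rangeRestrict c := LinearMap.congr_fun hrι (R.rangeRestrict c)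
    rw [this]
    exact counit_act_left ψ c
  · refine (mul_apply_eq_apply_left e f c).trans ?_
    rw [he]
    obtain ⟨d, hd⟩ := (r c).2
    rw [← hd]
    exact (mul_apply_eq_apply_left ψ f d).symm.trans (by rw [hf]; rfl)

/-- Principal left ideals of the dual algebra of a left hereditary coalgebra are projective. -/
theorem IsLeftHereditary.exists_mul_eq (H : IsLeftHereditary k C) (ψ : DualAlg k C) :
    ∃ e : DualAlg k C, e * ψ = ψ ∧ ∀ f : DualAlg k C, f * ψ = 0 → f * e = 0 := by
  let R : C →ₗ[k] C := (rightRegular k C).act ψ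
  have hR : ∀ (f : DualAlg k C) (c : C),
      R ((leftRegular k C).act f c) = (leftRegular k C).act f (R c) :=
    fun f c => (act_comm ψ f c).symm
  have hsurj := R.surjective_rangeRestrict
  obtain ⟨σ, hσ⟩ := (leftRegular k C).exists_isHom_of_surjective hsurj (by
    intro m hm f
    have hm' : R m = 0 := congrArg Subtype.val hm
    exact Subtype.ext ((hR f m).trans (by rw [hm', map_zero]; rfl)))
  have hinj := H C (LinearMap.range R) _ σ R.rangeRestrict isInjective_leftRegular hσ hsurj
  have hι : σ.IsHom (leftRegular k C) (LinearMap.range R).subtype := by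
    refine LeftComodule.isHom_of_act fun f n => ?_
    obtain ⟨c, rfl⟩ := hsurj n
    rw [← hσ.act]
    exact hR f c
  obtain ⟨r, hr, hrι⟩ := hinj _ _ σ (leftRegular k C) (LinearMap.range R).subtype LinearMap.id hι
    Subtype.val_injective (fun m => by simp)
  have hιr : (leftRegular k C).IsHom (leftRegular k C) ((LinearMap.range R).subtype ∘ₗ r) :=
    LeftComodule.isHom_of_act fun f c => by
      rw [LinearMap.comp_apply, LinearMap.comp_apply, hr.act, hι.act]
  let e : DualAlg k C := WithConv.toConv (Coalgebra.counit ∘ₗ (LinearMap.range R).subtype ∘ₗ r)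
  have he : ∀ c, (rightRegular k C).act e c = (r c : C) := fun c =>
    (LinearMap.congr_fun hιr.eq_coeff c).symm
  refine ⟨e, WithConv.ext (LinearMap.ext fun c => ?_),
    fun f hf => WithConv.ext (LinearMap.ext fun c => ?_)⟩
  · refine (mul_apply_eq_apply_right e ψ c).trans ?_
    change Coalgebra.counit (R := k) (r (R.rangeRestrict c) : C) = _
    have : r (R.rangeRestrict c) = R.rangeRestrict c := LinearMap.congr_fun hrι (R.rangeRestrict c)
    rw [this]
    exact counit_act_right ψ c
  · refine (mul_apply_eq_apply_right f e c).trans ?_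
    rw [he]
    obtain ⟨d, hd⟩ := (r c).2
    rw [← hd]
    exact (mul_apply_eq_apply_right f ψ d).symm.trans (by rw [hf]; rfl)

end Hereditary

/-! ### Embeddings in free modules -/

section Embedding

/-- An Artinian module whose points are separated by maps to `A` embeds in some `A^(I)`. -/
theorem EmbedsInFree.of_separating {S A : Type*} {M : Type w} [Ring S] [AddCommGroup A] [Module S A]
    [AddCommGroup M] [Module S M] [IsArtinian S M]
    (h : ∀ m : M, m ≠ 0 → ∃ F : M →ₗ[S] A, F m ≠ 0) : EmbedsInFree S A M := by
  -- All separating maps together would only land in a product. A map with minimal kernel is used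
  -- instead: a nonzero kernel element would permit one more coordinate and a smaller kernel.
  obtain ⟨K, ⟨I, F, rfl⟩, hmin⟩ := IsArtinian.set_has_minimal
    {K : Submodule S M | ∃ (I : Type w) (F : M →ₗ[S] (I →₀ A)), LinearMap.ker F = K}
    ⟨_, PEmpty, 0, rfl⟩
  refine ⟨I, F, LinearMap.ker_eq_bot.1 (by_contra fun hne => ?_)⟩
  obtain ⟨m, hm, hm0⟩ := (LinearMap.ker F).ne_bot_iff.1 hne
  obtain ⟨G, hG⟩ := h m hm0
  let F' : M →ₗ[S] (I ⊕ PUnit.{w + 1} →₀ A) :=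
    (Finsupp.sumFinsuppLEquivProdFinsupp S).symm.toLinearMap ∘ₗ
      F.prod (Finsupp.lsingle PUnit.unit ∘ₗ G)
  have hF' : ∀ x, F' x = 0 ↔ F x = 0 ∧ G x = 0 := by
    intro x
    have h1 : F' x = 0 ↔ (F.prod (Finsupp.lsingle PUnit.unit ∘ₗ G)) x = 0 :=
      (Finsupp.sumFinsuppLEquivProdFinsupp S).symm.map_eq_zero_iff
    rw [h1]
    simp
  refine hmin (LinearMap.ker F') ⟨_, F', rfl⟩ (lt_of_le_not_ge (fun x hx => ?_) fun hle => ?_)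
  · exact ((hF' x).1 hx).1
  · exact hG ((hF' m).1 (hle hm)).2

variable {k : Type u} {C : Type v} [Field k] [AddCommGroup C] [Module k C] [Coalgebra k C]

/-- Coefficient maps to `C` separate the points of `M`, since `ε (coeff μ m) = μ m`. Following them
by the coordinates of an embedding of `C` separates points by maps to `C^*`. -/
theorem IsLeftQcF.isLeftFQcF (H : IsLeftQcF k C) : IsLeftFQcF k C := by
  intro M _ _ _ ρ
  let := ρ.toModule
  let := (rightRegular k C).toModule
  have : IsScalarTower k (DualAlg k C) M := ⟨ρ.act_smul⟩
  have : IsArtinian (DualAlg k C) M := isArtinian_of_tower k inferInstance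
  obtain ⟨I, F, hF⟩ := H
  refine .of_separating fun m hm => ?_
  obtain ⟨μ, hμ⟩ : ∃ μ : M →ₗ[k] k, μ m ≠ 0 := by
    by_contra! h
    exact hm ((Module.forall_dual_apply_eq_zero_iff k m).1 h)
  let G : M →ₗ[DualAlg k C] C :=
    { toFun := ρ.coeff μ, map_add' := map_add _, map_smul' := ρ.coeff_act μ }
  have hG : G m ≠ 0 := fun h => hμ (by
    rw [← ρ.counit_coeff μ m]
    exact (congrArg _ h).trans (map_zero _))
  obtain ⟨i, hi⟩ := Finsupp.ne_iff.1 (((map_ne_zero_iff F hF).2 hG))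
  exact ⟨Finsupp.lapply i ∘ₗ F ∘ₗ G, hi⟩

theorem IsRightQcF.isRightFQcF (H : IsRightQcF k C) : IsRightFQcF k C := by
  intro M _ _ _ ρ
  let := ρ.toModule
  let := (leftRegular k C).toModule
  have : IsScalarTower k (DualAlg k C)ᵐᵒᵖ M := ⟨fun a f => ρ.act_smul a f.unop⟩
  have : IsArtinian (DualAlg k C)ᵐᵒᵖ M := isArtinian_of_tower k inferInstance
  obtain ⟨I, F, hF⟩ := H
  refine .of_separating fun m hm => ?_
  obtain ⟨μ, hμ⟩ : ∃ μ : M →ₗ[k] k, μ m ≠ 0 := by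
    by_contra! h
    exact hm ((Module.forall_dual_apply_eq_zero_iff k m).1 h)
  let G : M →ₗ[(DualAlg k C)ᵐᵒᵖ] C :=
    { toFun := ρ.coeff μ, map_add' := map_add _, map_smul' := fun f => ρ.coeff_act μ f.unop }
  have hG : G m ≠ 0 := fun h => hμ (by
    rw [← ρ.counit_coeff μ m]
    exact (congrArg _ h).trans (map_zero _))
  obtain ⟨i, hi⟩ := Finsupp.ne_iff.1 (((map_ne_zero_iff F hF).2 hG))
  exact ⟨Finsupp.lapply i ∘ₗ F ∘ₗ G, hi⟩

theorem IsLeftCoFrobenius.isLeftQcF (H : IsLeftCoFrobenius k C) : IsLeftQcF k C := by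
  let := (rightRegular k C).toModule
  obtain ⟨F, hF⟩ := H
  exact ⟨PUnit, Finsupp.lsingle PUnit.unit ∘ₗ F, (Finsupp.single_injective _).comp hF⟩

theorem IsRightCoFrobenius.isRightQcF (H : IsRightCoFrobenius k C) : IsRightQcF k C := by
  let := (leftRegular k C).toModule
  obtain ⟨F, hF⟩ := H
  exact ⟨PUnit, Finsupp.lsingle PUnit.unit ∘ₗ F, (Finsupp.single_injective _).comp hF⟩

/-- The one-dimensional right comodule of a group-like element. -/
def RightComodule.ofGroupLike {g : C} (hg : IsGroupLikeElem k g) : RightComodule k C k where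
  coact := (TensorProduct.mk k k C).flip g
  coassoc m := by simp [hg.comul_eq_tmul_self]
  counit m := by simp [hg.counit_eq_one]

/-- The one-dimensional left comodule of a group-like element. -/
def LeftComodule.ofGroupLike {g : C} (hg : IsGroupLikeElem k g) : LeftComodule k C k where
  coact := TensorProduct.mk k C k g
  coassoc m := by simp [hg.comul_eq_tmul_self]
  counit m := by simp [hg.counit_eq_one]

theorem IsLeftFQcF.exists_mul_eq (H : IsLeftFQcF k C) {g : C} (hg : IsGroupLikeElem k g) :
    ∃ φ : DualAlg k C, φ ≠ 0 ∧ ∀ f : DualAlg k C, f * φ = f g • φ := by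
  obtain ⟨I, F, hF⟩ := H k (RightComodule.ofGroupLike hg)
  let := (RightComodule.ofGroupLike hg).toModule
  obtain ⟨i, hi⟩ := Finsupp.ne_iff.1 ((map_ne_zero_iff F hF).2 (one_ne_zero (α := k)))
  refine ⟨F 1 i, hi, fun f => ?_⟩
  -- The scalar `f g` is written as an element of `C^*`, because `F` is only known to be linear over
  -- `C^*`.
  have h1 : f • (1 : k) = (f g • (1 : DualAlg k C)) • (1 : k) := by
    change (RightComodule.ofGroupLike hg).act f 1 = (RightComodule.ofGroupLike hg).act _ 1
    rw [RightComodule.act_smul, RightComodule.act_one]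
    simp [RightComodule.act, RightComodule.ofGroupLike]
  have h2 : f • F 1 = (f g • (1 : DualAlg k C)) • F 1 := by rw [← map_smul, h1, map_smul]
  have h3 : f * F 1 i = (f g • (1 : DualAlg k C)) * F 1 i := DFunLike.congr_fun h2 i
  rw [h3, smul_mul_assoc, one_mul]

theorem IsRightFQcF.exists_mul_eq (H : IsRightFQcF k C) {g : C} (hg : IsGroupLikeElem k g) :
    ∃ φ : DualAlg k C, φ ≠ 0 ∧ ∀ f : DualAlg k C, φ * f = f g • φ := by
  obtain ⟨I, F, hF⟩ := H k (LeftComodule.ofGroupLike hg)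
  let := (LeftComodule.ofGroupLike hg).toModule
  obtain ⟨i, hi⟩ := Finsupp.ne_iff.1 ((map_ne_zero_iff F hF).2 (one_ne_zero (α := k)))
  refine ⟨F 1 i, hi, fun f => ?_⟩
  have h1 : MulOpposite.op f • (1 : k) = MulOpposite.op (f g • (1 : DualAlg k C)) • (1 : k) := by
    change (LeftComodule.ofGroupLike hg).act f 1 = (LeftComodule.ofGroupLike hg).act (f g • 1) 1
    rw [LeftComodule.act_smul, LeftComodule.act_one]
    simp [LeftComodule.act, LeftComodule.ofGroupLike]
  have h2 : MulOpposite.op f • F 1 = MulOpposite.op (f g • (1 : DualAlg k C)) • F 1 := by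
    rw [← map_smul, h1, map_smul]
  have h3 : F 1 i * f = F 1 i * (f g • (1 : DualAlg k C)) := DFunLike.congr_fun h2 i
  rw [h3, mul_smul_comm, mul_one]

end Embedding

/-! ### Skew-primitive elements -/

section Skew

variable {k : Type u} {C : Type v} [Field k] [AddCommGroup C] [Module k C] [Coalgebra k C]

theorem mul_apply_of_mem_skewPrimitive {g h x : C} (hx : x ∈ skewPrimitive k g h)
    (f₁ f₂ : DualAlg k C) : (f₁ * f₂) x = f₁ g * f₂ x + f₁ x * f₂ h := by
  have hx' : Coalgebra.comul (R := k) x = g ⊗ₜ[k] x + x ⊗ₜ[k] h := hx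
  simp [hx']

/-- Evaluating `ε * ε = ε` at `x` gives `ε x = 0`, so the two coefficients are opposite. -/
theorem mem_span_sub_of_mem_skewPrimitive {g h x : C} (hg : IsGroupLikeElem k g)
    (hh : IsGroupLikeElem k h) (hx : x ∈ skewPrimitive k g h)
    (hs : x ∈ Submodule.span k {g, h}) : x ∈ k ∙ (g - h) := by
  obtain ⟨a, b, rfl⟩ := Submodule.mem_span_pair.1 hs
  have h1 := mul_apply_of_mem_skewPrimitive hx 1 1
  rw [one_mul] at h1
  simp only [map_add, map_smul, LinearMap.convOne_apply, hg.counit_eq_one, hh.counit_eq_one,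
    smul_eq_mul, mul_one, one_mul, Algebra.algebraMap_self, RingHom.id_apply] at h1
  have hb : b = -a := by linear_combination -h1
  exact Submodule.mem_span_singleton.2 ⟨a, by rw [hb]; module⟩

theorem exists_functional_of_mem_skewPrimitive {g h x : C} (hg : IsGroupLikeElem k g)
    (hh : IsGroupLikeElem k h) (hx : x ∈ skewPrimitive k g h) (hn : x ∉ k ∙ (g - h)) :
    ∃ ξ : DualAlg k C, ξ g = 0 ∧ ξ h = 0 ∧ ξ x ≠ 0 := by
  obtain ⟨ξ, hξx, hξ⟩ := Submodule.exists_le_ker_of_notMem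
    fun hs => hn (mem_span_sub_of_mem_skewPrimitive hg hh hx hs)
  exact ⟨WithConv.toConv ξ, hξ (Submodule.subset_span (by simp)),
    hξ (Submodule.subset_span (by simp)), hξx⟩

end Skew

/-! ### Skew-primitives of a hereditary f-qcF coalgebra are trivial -/

section SkewHereditary

variable {k : Type u} {C : Type u} [Field k] [AddCommGroup C] [Module k C] [Coalgebra k C]

theorem IsHereditary.mem_span_sub_of_isLeftFQcF (H : IsHereditary k C) (HF : IsLeftFQcF k C)
    {g h x : C} (hg : IsGroupLikeElem k g) (hh : IsGroupLikeElem k h)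
    (hx : x ∈ skewPrimitive k g h) : x ∈ k ∙ (g - h) := by
  by_contra hn
  obtain ⟨ξ, hξg, hξh, hξx⟩ := exists_functional_of_mem_skewPrimitive hg hh hx hn
  obtain ⟨φ, hφ, hφm⟩ := HF.exists_mul_eq hh
  have hξφ : ξ * φ = 0 := by rw [hφm, hξh, zero_smul]
  obtain H | H := H
  -- From `e * φ = 0` follows `e h = 0`, so both terms of `(ξ * e) x = ξ g * e x + ξ x * e h`
  -- vanish, whereas `ξ * e = ξ`.
  · obtain ⟨e, he, hef⟩ := H.exists_mul_eq ξ
    have h1 : e h = 0 := by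
      have := hef φ hξφ
      rw [hφm] at this
      exact (smul_eq_zero.1 this).resolve_right hφ
    have h2 := mul_apply_of_mem_skewPrimitive hx ξ e
    rw [he, h1, hξg] at h2
    simp at h2
    exact hξx h2
  -- Here the ideal is generated by `φ`: `e * φ = φ` gives `e h = 1`, and `ξ * e = 0` evaluated at
  -- `x` leaves `ξ x = 0`.
  · obtain ⟨e, he, hef⟩ := H.exists_mul_eq φ
    have h1 : e h = 1 := by
      rw [hφm] at he
      exact smul_left_injective k hφ (by simpa using he)
    have h2 := mul_apply_of_mem_skewPrimitive hx ξ e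
    rw [hef ξ hξφ, h1, hξg] at h2
    simp at h2
    exact hξx h2.symm

/-- The mirror argument: now `φ * f = f g • φ`, so `φ * ξ = 0`, and the two kinds of hereditariness
exchange their roles. -/
theorem IsHereditary.mem_span_sub_of_isRightFQcF (H : IsHereditary k C) (HF : IsRightFQcF k C)
    {g h x : C} (hg : IsGroupLikeElem k g) (hh : IsGroupLikeElem k h)
    (hx : x ∈ skewPrimitive k g h) : x ∈ k ∙ (g - h) := by
  by_contra hn
  obtain ⟨ξ, hξg, hξh, hξx⟩ := exists_functional_of_mem_skewPrimitive hg hh hx hn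
  obtain ⟨φ, hφ, hφm⟩ := HF.exists_mul_eq hg
  have hφξ : φ * ξ = 0 := by rw [hφm, hξg, zero_smul]
  obtain H | H := H
  · obtain ⟨e, he, hef⟩ := H.exists_mul_eq φ
    have h1 : e g = 1 := by
      rw [hφm] at he
      exact smul_left_injective k hφ (by simpa using he)
    have h2 := mul_apply_of_mem_skewPrimitive hx e ξ
    rw [hef ξ hφξ, h1, hξh] at h2
    simp at h2
    exact hξx h2.symm
  · obtain ⟨e, he, hef⟩ := H.exists_mul_eq ξ
    have h1 : e g = 0 := by
      have := hef φ hφξ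
      rw [hφm] at this
      exact (smul_eq_zero.1 this).resolve_right hφ
    have h2 := mul_apply_of_mem_skewPrimitive hx e ξ
    rw [he, h1, hξh] at h2
    simp at h2
    exact hξx h2

end SkewHereditary

/-! ### Coalgebras spanned by group-like elements -/

section GroupLike

variable {k : Type u} {C : Type v} [Field k] [AddCommGroup C] [Module k C] [Coalgebra k C]

variable (k C) in
/-- The span of the group-like elements. -/
def groupLikeSpan : Submodule k C := Submodule.span k {g : C | IsGroupLikeElem k g}

theorem range_coe_groupLike : Submodule.span k
      (Set.range ((↑) : {g : C // IsGroupLikeElem k g} → C)) = groupLikeSpan k C := by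
  rw [Subtype.range_coe_subtype]
  rfl

theorem _root_.IsGroupLikeElem.act_right {g : C} (hg : IsGroupLikeElem k g) (f : DualAlg k C) :
    (rightRegular k C).act f g = f g • g := by
  simp [RightComodule.act, rightRegular, hg.comul_eq_tmul_self]

theorem _root_.IsGroupLikeElem.act_left {g : C} (hg : IsGroupLikeElem k g) (f : DualAlg k C) :
    (leftRegular k C).act f g = f g • g := by
  simp [LeftComodule.act, leftRegular, hg.comul_eq_tmul_self]

theorem _root_.IsGroupLikeElem.mul_apply {g : C} (hg : IsGroupLikeElem k g) (f₁ f₂ : DualAlg k C) :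
    (f₁ * f₂) g = f₁ g * f₂ g := by
  simp [hg.comul_eq_tmul_self]

/-- Group-likes are linearly independent, hence a basis. In the dual basis pairing, both
translations scale a group-like `g` by `f g`, and both products with `f` scale its dual functional
by the same factor. -/
theorem exists_pairing_of_groupLikeSpan_eq_top (H : groupLikeSpan k C = ⊤) :
    ∃ F : C →ₗ[k] DualAlg k C, Function.Injective F ∧
      (∀ f c, F ((rightRegular k C).act f c) = f * F c) ∧
      ∀ f c, F ((leftRegular k C).act f c) = F c * f := by
  classical
  let b : Module.Basis {g : C // IsGroupLikeElem k g} k C := Module.Basis.mk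
    (linearIndepOn_isGroupLikeElem (R := k) (A := C)) (by rw [← H, ← range_coe_groupLike]; rfl)
  have hb : ∀ g, b g = g := fun g => Module.Basis.mk_apply _ _ g
  let F : C →ₗ[k] DualAlg k C :=
    (WithConv.linearEquiv k (C →ₗ[k] k)).symm.toLinearMap ∘ₗ b.toDual
  have hF : ∀ g h, F (b g) (b h) = if g = h then 1 else 0 := b.toDual_apply
  refine ⟨F, (WithConv.linearEquiv k (C →ₗ[k] k)).symm.injective.comp b.toDual_injective,
    fun f c => ?_, fun f c => ?_⟩
  · refine LinearMap.congr_fun (b.ext (f₁ := F ∘ₗ (rightRegular k C).act f)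
      (f₂ := LinearMap.mulLeft k f ∘ₗ F) fun g => WithConv.ext (b.ext fun h => ?_)) c
    change F ((rightRegular k C).act f (b g)) (b h) = (f * F (b g)) (b h)
    rw [hb g, g.2.act_right, hb h, h.2.mul_apply, ← hb g, ← hb h, hF, map_smul]
    change f (b g) * F (b g) (b h) = _
    rw [hF]
    split_ifs with hgh <;> simp [hgh]
  · refine LinearMap.congr_fun (b.ext (f₁ := F ∘ₗ (leftRegular k C).act f)
      (f₂ := LinearMap.mulRight k f ∘ₗ F) fun g => WithConv.ext (b.ext fun h => ?_)) c
    change F ((leftRegular k C).act f (b g)) (b h) = (F (b g) * f) (b h)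
    rw [hb g, g.2.act_left, hb h, h.2.mul_apply, ← hb g, ← hb h, hF, map_smul]
    change f (b g) * F (b g) (b h) = _
    rw [hF]
    split_ifs with hgh <;> simp [hgh]

theorem isLeftCoFrobenius_of_groupLikeSpan_eq_top (H : groupLikeSpan k C = ⊤) :
    IsLeftCoFrobenius k C := by
  obtain ⟨F, hF, hl, -⟩ := exists_pairing_of_groupLikeSpan_eq_top H
  let := (rightRegular k C).toModule
  exact ⟨{ toFun := F, map_add' := map_add F, map_smul' := hl }, hF⟩

theorem isRightCoFrobenius_of_groupLikeSpan_eq_top (H : groupLikeSpan k C = ⊤) :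
    IsRightCoFrobenius k C := by
  obtain ⟨F, hF, -, hr⟩ := exists_pairing_of_groupLikeSpan_eq_top H
  let := (leftRegular k C).toModule
  exact ⟨{ toFun := F, map_add' := map_add F, map_smul' := fun f => hr f.unop }, hF⟩

theorem IsSubcoalgebra.act_right_mem {D : Submodule k C} (hD : IsSubcoalgebra k D)
    (f : DualAlg k C) {c : C} (hc : c ∈ D) : (rightRegular k C).act f c ∈ D := by
  obtain ⟨t, ht⟩ := hD c hc
  change TensorProduct.rid k C (f.ofConv.lTensor C (Coalgebra.comul (R := k) c)) ∈ D
  rw [← ht]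
  generalize t = z
  induction z with
  | zero => simp
  | add x y hx hy => simpa only [map_add] using add_mem hx hy
  | tmul x y => simpa using D.smul_mem _ x.2

theorem IsSubcoalgebra.act_left_mem {D : Submodule k C} (hD : IsSubcoalgebra k D)
    (f : DualAlg k C) {c : C} (hc : c ∈ D) : (leftRegular k C).act f c ∈ D := by
  obtain ⟨t, ht⟩ := hD c hc
  change TensorProduct.lid k C (f.ofConv.rTensor C (Coalgebra.comul (R := k) c)) ∈ D
  rw [← ht]
  generalize t = z
  induction z with
  | zero => simp
  | add x y hx hy => simpa only [map_add] using add_mem hx hy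
  | tmul x y => simpa using D.smul_mem _ y.2

theorem isSubcoalgebra_of_act_mem {D : Submodule k C}
    (hr : ∀ (f : DualAlg k C), ∀ c ∈ D, (rightRegular k C).act f c ∈ D)
    (hl : ∀ (f : DualAlg k C), ∀ c ∈ D, (leftRegular k C).act f c ∈ D) :
    IsSubcoalgebra k D := fun c hc =>
  mem_range_map_subtype (fun f => hr (WithConv.toConv f) c hc)
    fun f => hl (WithConv.toConv f) c hc

theorem _root_.IsGroupLikeElem.isSimpleSubcoalgebra {g : C} (hg : IsGroupLikeElem k g) :
    IsSimpleSubcoalgebra k (k ∙ g) := by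
  refine ⟨isSubcoalgebra_of_act_mem (fun f c hc => ?_) (fun f c hc => ?_), ?_, fun E _ hE => ?_⟩
  · obtain ⟨a, rfl⟩ := Submodule.mem_span_singleton.1 hc
    rw [map_smul, hg.act_right]
    exact Submodule.smul_mem _ _ (Submodule.smul_mem _ _ (Submodule.mem_span_singleton_self g))
  · obtain ⟨a, rfl⟩ := Submodule.mem_span_singleton.1 hc
    rw [map_smul, hg.act_left]
    exact Submodule.smul_mem _ _ (Submodule.smul_mem _ _ (Submodule.mem_span_singleton_self g))
  · simpa using hg.ne_zero
  · exact ((nonzero_span_atom g hg.ne_zero).le_iff).1 hE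

theorem isCosemisimple_of_groupLikeSpan_eq_top (H : groupLikeSpan k C = ⊤) :
    IsCosemisimple k C := by
  refine eq_top_iff.2 (H ▸ Submodule.span_le.2 fun g hg => ?_)
  exact le_sSup (a := k ∙ g) (IsGroupLikeElem.isSimpleSubcoalgebra hg)
    (Submodule.mem_span_singleton_self g)

/-- One-dimensional subcoalgebras are spanned by a group-like element. -/
theorem IsSubcoalgebra.exists_isGroupLikeElem {D : Submodule k C} (hD : IsSubcoalgebra k D)
    (h1 : Module.finrank k D = 1) : ∃ g, IsGroupLikeElem k g ∧ D = k ∙ g := by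
  obtain ⟨x, hx0, hx⟩ := finrank_eq_one_iff'.1 h1
  have hDx : D = k ∙ (x : C) := by
    refine le_antisymm (fun y hy => ?_) ((Submodule.span_singleton_le_iff_mem _ _).2 x.2)
    obtain ⟨c, hc⟩ := hx ⟨y, hy⟩
    exact Submodule.mem_span_singleton.2 ⟨c, congrArg Subtype.val hc⟩
  obtain ⟨a, ha⟩ : ∃ a : k, Coalgebra.comul (R := k) (x : C) = a • ((x : C) ⊗ₜ[k] (x : C)) := by
    obtain ⟨t, ht⟩ := hD x x.2
    rw [← ht]
    generalize t = z
    induction z with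
    | zero => exact ⟨0, by simp⟩
    | add y z hy hz =>
      obtain ⟨a, ha⟩ := hy
      obtain ⟨b, hb⟩ := hz
      exact ⟨a + b, by rw [map_add, ha, hb, add_smul]⟩
    | tmul y z =>
      obtain ⟨a, rfl⟩ := hx y
      obtain ⟨b, rfl⟩ := hx z
      exact ⟨a * b, by simp [TensorProduct.smul_tmul', TensorProduct.tmul_smul, smul_smul,
        mul_comm]⟩
  have hx0' : (x : C) ≠ 0 := fun h => hx0 (Subtype.ext h)
  -- The counit axiom fixes the normalisation: with `Δ x = a • (x ⊗ x)`, the group-like generator is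
  -- `a • x`.
  have hε : a * Coalgebra.counit (R := k) (x : C) = 1 := by
    have h := Coalgebra.rTensor_counit_comul (R := k) (x : C)
    have h' := congrArg (TensorProduct.lid k C) h
    rw [ha] at h'
    simp only [map_smul, LinearMap.rTensor_tmul, TensorProduct.lid_tmul, one_smul, smul_smul] at h'
    exact smul_left_injective k hx0' (by simpa using h')
  have ha0 : a ≠ 0 := left_ne_zero_of_mul_eq_one hε
  refine ⟨a • (x : C), ⟨by simpa using hε, ?_⟩, ?_⟩
  · rw [map_smul, ha, TensorProduct.smul_tmul', TensorProduct.tmul_smul]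
  · exact hDx.trans (Submodule.span_singleton_smul_eq (IsUnit.mk0 a ha0) _).symm

theorem IsPointed.groupLikeSpan_eq_top (HP : IsPointed k C) (H : IsCosemisimple k C) :
    groupLikeSpan k C = ⊤ := by
  refine eq_top_iff.2 (H ▸ sSup_le fun D hD => ?_)
  obtain ⟨g, hg, rfl⟩ := hD.1.exists_isGroupLikeElem (HP D hD)
  exact (Submodule.span_singleton_le_iff_mem _ _).2 (Submodule.subset_span hg)

end GroupLike

/-! ### Simple submodules and maps from semisimple modules -/

section Socle

theorem exists_isSimpleModule_of_isArtinian_span {A M : Type*} [Ring A] [AddCommGroup M]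
    [Module A M] {m : M} (hm : m ≠ 0) [IsArtinian A (Submodule.span A {m})] :
    ∃ S : Submodule A M, IsSimpleModule A S := by
  have : Nontrivial (Submodule.span A {m}) := ⟨⟨⟨m, Submodule.mem_span_singleton_self _⟩, 0,
    fun h => hm (congrArg Subtype.val h)⟩⟩
  obtain ⟨S, hS, -⟩ := (eq_bot_or_exists_atom_le
    (⊤ : Submodule A (Submodule.span A {m}))).resolve_left top_ne_bot
  have := isSimpleModule_iff_isAtom.2 hS
  exact ⟨S.map (Submodule.span A {m}).subtype, IsSimpleModule.congr
    (Submodule.equivMapOfInjective _ Subtype.val_injective S).symm⟩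

/-- A direct sum of copies of `S` is semisimple, so the inclusion of the submodule generated by `g`
lifts through `φ`. The lift is nonzero at `g`, and so is one of its coordinates. -/
theorem exists_linearMap_ne_zero_of_mem_range {A ι S N : Type*} [Ring A] [AddCommGroup S]
    [Module A S] [IsSimpleModule A S] [AddCommGroup N] [Module A N] (φ : (ι →₀ S) →ₗ[A] N)
    {g : N} (hg : g ∈ LinearMap.range φ) (hg0 : g ≠ 0) :
    ∃ h : Submodule.span A {g} →ₗ[A] S, h ⟨g, Submodule.mem_span_singleton_self g⟩ ≠ 0 := by
  have hL : Submodule.span A {g} ≤ LinearMap.range φ :=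
    (Submodule.span_singleton_le_iff_mem _ _).2 hg
  obtain ⟨h, hh⟩ := IsSemisimpleModule.lifting_property φ.rangeRestrict
    φ.surjective_rangeRestrict (Submodule.inclusion hL)
  obtain ⟨i, hi⟩ := Finsupp.ne_iff.1
    (show h ⟨g, Submodule.mem_span_singleton_self g⟩ ≠ 0 from fun h0 => by
      have h1 := congrArg Subtype.val
        (LinearMap.congr_fun hh ⟨g, Submodule.mem_span_singleton_self g⟩)
      rw [LinearMap.comp_apply, h0, map_zero] at h1
      exact hg0 h1.symm)
  exact ⟨Finsupp.lapply i ∘ₗ h, hi⟩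

end Socle

/-! ### Pointed coalgebras -/

section Pointed

variable {k : Type u} {C : Type v} [Field k] [AddCommGroup C] [Module k C] [Coalgebra k C]

/-- Every element of a coalgebra lies in a finite-dimensional subcoalgebra. -/
theorem exists_finite_subcoalgebra_mem (c : C) : ∃ E : Submodule k C, IsSubcoalgebra k E ∧
    FiniteDimensional k E ∧ c ∈ E := by
  let E : Submodule k C := Submodule.span k (Set.range fun q : DualAlg k C × DualAlg k C =>
    (rightRegular k C).act q.1 ((leftRegular k C).act q.2 c))
  have hmem : ∀ f g : DualAlg k C,
      (rightRegular k C).act f ((leftRegular k C).act g c) ∈ E := fun f g =>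
    Submodule.subset_span ⟨(f, g), rfl⟩
  refine ⟨E, isSubcoalgebra_of_act_mem (fun h x hx => ?_) (fun h x hx => ?_), ?_, ?_⟩
  · refine Submodule.span_le (p := E.comap ((rightRegular k C).act h)) |>.2 ?_ hx
    rintro _ ⟨⟨f, g⟩, rfl⟩
    change (rightRegular k C).act h _ ∈ E
    rw [← RightComodule.act_mul]
    exact hmem _ _
  · refine Submodule.span_le (p := E.comap ((leftRegular k C).act h)) |>.2 ?_ hx
    rintro _ ⟨⟨f, g⟩, rfl⟩
    change (leftRegular k C).act h _ ∈ E
    rw [act_comm, ← LeftComodule.act_mul]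
    exact hmem _ _
  -- The left translates of `c` lie in a finite-dimensional `P`, and the right translates of each of
  -- the finitely many basis vectors of `P` lie in a finite-dimensional `Q i`.
  · obtain ⟨P, _, hP⟩ := exists_finite_rTensor_mem (Coalgebra.comul (R := k) c)
    let b := Module.finBasis k P
    choose Q hQ hQb using fun i => exists_finite_lTensor_mem (Coalgebra.comul (R := k) (b i : C))
    refine Submodule.finiteDimensional_of_le (S₂ := ⨆ i, Q i) (Submodule.span_le.2 ?_)
    rintro _ ⟨⟨f, g⟩, rfl⟩
    have hg : (leftRegular k C).act g c ∈ P := hP g.ofConv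
    have hsum := congrArg Subtype.val (b.sum_repr ⟨_, hg⟩)
    simp only [SetLike.mem_coe]
    rw [show (leftRegular k C).act g c = _ from hsum.symm]
    simp only [AddSubmonoidClass.coe_finsetSum, Submodule.coe_smul, map_sum, map_smul]
    exact sum_mem fun i _ => Submodule.smul_mem _ _
      (Submodule.mem_iSup_of_mem i (hQb i f.ofConv))
  · simpa [RightComodule.act_one, LeftComodule.act_one] using hmem 1 1

theorem IsSubcoalgebra.inf {D E : Submodule k C} (hD : IsSubcoalgebra k D)
    (hE : IsSubcoalgebra k E) : IsSubcoalgebra k (D ⊓ E) :=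
  isSubcoalgebra_of_act_mem
    (fun f _ hc => ⟨hD.act_right_mem f hc.1, hE.act_right_mem f hc.2⟩)
    fun f _ hc => ⟨hD.act_left_mem f hc.1, hE.act_left_mem f hc.2⟩

/-- Every nonzero subcoalgebra contains a simple subcoalgebra. -/
theorem IsSubcoalgebra.exists_isSimpleSubcoalgebra_le {D : Submodule k C}
    (hD : IsSubcoalgebra k D) (h0 : D ≠ ⊥) : ∃ E ≤ D, IsSimpleSubcoalgebra k E := by
  obtain ⟨c, hc, hc0⟩ := D.ne_bot_iff.1 h0
  obtain ⟨E, hE, hfin, hcE⟩ := exists_finite_subcoalgebra_mem (k := k) c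
  -- Intersecting `D` with a finite-dimensional subcoalgebra supplies a candidate, so one of least
  -- dimension exists.
  obtain ⟨S, ⟨hS, hSfin, hS0, hSD⟩, hmin⟩ := WellFounded.has_min
    (measure fun S : Submodule k C => Module.finrank k S).wf
    {S | IsSubcoalgebra k S ∧ FiniteDimensional k S ∧ S ≠ ⊥ ∧ S ≤ D}
    ⟨D ⊓ E, hD.inf hE, inferInstance, (Submodule.ne_bot_iff _).2 ⟨c, ⟨hc, hcE⟩, hc0⟩, inf_le_left⟩
  refine ⟨S, hSD, hS, hS0, fun F hF hFS => ?_⟩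
  by_contra! h
  have hFfin : FiniteDimensional k F := Submodule.finiteDimensional_of_le hFS
  exact hmin F ⟨hF, hFfin, h.1, hFS.trans hSD⟩
    (Submodule.finrank_lt_finrank_of_lt (lt_of_le_of_ne hFS h.2))

/-- The socle of a nonzero comodule over a pointed coalgebra contains a one-dimensional
subcomodule. -/
theorem IsPointed.exists_act_eq_smul (HP : IsPointed k C) {M : Type w} [AddCommGroup M]
    [Module k M] (ρ : RightComodule k C M) [Nontrivial M] :
    ∃ m : M, m ≠ 0 ∧ ∃ g : C, IsGroupLikeElem k g ∧ ∀ f : DualAlg k C, ρ.act f m = f g • m := by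
  let := ρ.toModule
  let := (rightRegular k C).toModule
  have : IsScalarTower k (DualAlg k C) M := ⟨ρ.act_smul⟩
  have : IsScalarTower k (DualAlg k C) C := ⟨(rightRegular k C).act_smul⟩
  obtain ⟨m₀, hm₀⟩ := exists_ne (0 : M)
  let N : Submodule (DualAlg k C) M := Submodule.span (DualAlg k C) {m₀}
  obtain ⟨P, _, hP⟩ := exists_finite_lTensor_mem (ρ.coact m₀)
  have hNP : N.restrictScalars k ≤ P := by
    intro x hx
    obtain ⟨f, rfl⟩ := Submodule.mem_span_singleton.1 hx
    exact hP f.ofConv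
  have hNfin : FiniteDimensional k (N.restrictScalars k) := Submodule.finiteDimensional_of_le hNP
  have hNart : IsArtinian k N := inferInstanceAs (IsArtinian k (N.restrictScalars k))
  have : IsArtinian (DualAlg k C) N := isArtinian_of_tower k hNart
  obtain ⟨S, hS⟩ := exists_isSimpleModule_of_isArtinian_span (A := DualAlg k C) hm₀
  let j : S →ₗ[DualAlg k C] M := S.subtype
  have hj : Function.Injective j := Subtype.val_injective
  let γ (μ : M →ₗ[k] k) : M →ₗ[DualAlg k C] C :=
    { toFun := ρ.coeff μ, map_add' := map_add _, map_smul' := ρ.coeff_act μ }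
  -- The range of `φ` is the coefficient space of `S`. It is a subcoalgebra, so pointedness puts a
  -- group-like `g` in it; it is also a quotient of copies of `S`, so the line of `g` maps
  -- nontrivially to `S`.
  let φ : ((M →ₗ[k] k) →₀ S) →ₗ[DualAlg k C] C := Finsupp.lsum ℕ fun μ => γ μ ∘ₗ j
  have hφ : ∀ μ s, φ (Finsupp.single μ s) = ρ.coeff μ (j s) := fun μ s =>
    Finsupp.lsum_single _ _ _ _
  let D : Submodule k C := (LinearMap.range φ).restrictScalars k
  have hD : IsSubcoalgebra k D := by
    refine isSubcoalgebra_of_act_mem (fun f c hc => (LinearMap.range φ).smul_mem f hc) ?_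
    rintro f _ ⟨x, rfl⟩
    induction x using Finsupp.induction_linear with
    | zero => rw [map_zero, map_zero]; exact zero_mem _
    | add x y hx hy => rw [map_add, map_add]; exact add_mem hx hy
    | single μ s =>
      rw [hφ, ← ρ.coeff_comp_act, ← hφ]
      exact ⟨_, rfl⟩
  have hD0 : D ≠ ⊥ := by
    have := IsSimpleModule.nontrivial (DualAlg k C) S
    obtain ⟨s, hs⟩ := exists_ne (0 : S)
    have hjs : j s ≠ 0 := (map_ne_zero_iff j hj).2 hs
    obtain ⟨μ, hμ⟩ : ∃ μ : M →ₗ[k] k, μ (j s) ≠ 0 := by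
      by_contra! h
      exact hjs ((Module.forall_dual_apply_eq_zero_iff k _).1 h)
    refine D.ne_bot_iff.2 ⟨ρ.coeff μ (j s), ⟨_, hφ μ s⟩, fun h => hμ ?_⟩
    rw [← ρ.counit_coeff, h, map_zero]
  obtain ⟨E, hED, hE⟩ := hD.exists_isSimpleSubcoalgebra_le hD0
  obtain ⟨g, hg, rfl⟩ := hE.1.exists_isGroupLikeElem (HP E hE)
  have hgφ : g ∈ LinearMap.range φ := hED (Submodule.mem_span_singleton_self g)
  obtain ⟨h, hh⟩ := exists_linearMap_ne_zero_of_mem_range (A := DualAlg k C) (S := S) φ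
    hgφ hg.ne_zero
  let g' : Submodule.span (DualAlg k C) {g} := ⟨g, Submodule.mem_span_singleton_self g⟩
  have hfg : ∀ f : DualAlg k C, f • g' = (f g • (1 : DualAlg k C)) • g' := by
    intro f
    refine Subtype.ext ?_
    change (rightRegular k C).act f g = (rightRegular k C).act _ g
    rw [hg.act_right, RightComodule.act_smul, RightComodule.act_one]
  refine ⟨j (h g'), (map_ne_zero_iff j hj).2 hh, g, hg, fun f => ?_⟩
  have h2 : f • h g' = (f g • (1 : DualAlg k C)) • h g' := by rw [← map_smul, hfg, map_smul]
  have h3 := congrArg j h2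
  rw [map_smul, map_smul] at h3
  refine h3.trans ?_
  change ρ.act (f g • (1 : DualAlg k C)) _ = _
  rw [ρ.act_smul, ρ.act_one]

theorem mem_skewPrimitive_of_mul_apply {g h x : C}
    (H : ∀ f₁ f₂ : DualAlg k C, (f₁ * f₂) x = f₁ g * f₂ x + f₁ x * f₂ h) :
    x ∈ skewPrimitive k g h := by
  refine eq_of_lTensor_eq fun f => dual_ext fun f₁ : DualAlg k C => ?_
  refine (mul_apply_eq_apply_right f₁ (WithConv.toConv f) x).symm.trans ((H _ _).trans ?_)
  simp [mul_comm]

theorem groupLikeSpan_act_right_mem (f : DualAlg k C) {c : C} (hc : c ∈ groupLikeSpan k C) :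
    (rightRegular k C).act f c ∈ groupLikeSpan k C := by
  refine Submodule.span_le (p := (groupLikeSpan k C).comap ((rightRegular k C).act f)) |>.2 ?_ hc
  intro g hg
  change (rightRegular k C).act f g ∈ groupLikeSpan k C
  rw [IsGroupLikeElem.act_right hg]
  exact Submodule.smul_mem _ _ (Submodule.subset_span hg)

/-- The condition says that the first leg of `t` lies in the span of the group-likes, so `t = ∑ g ⊗
y_g`. -/
theorem exists_finsupp_of_lTensor_mem_groupLikeSpan {t : C ⊗[k] C}
    (ht : ∀ f : C →ₗ[k] k, TensorProduct.rid k C (f.lTensor C t) ∈ groupLikeSpan k C) :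
    ∃ y : {g : C // IsGroupLikeElem k g} →₀ C, ∀ f : C →ₗ[k] k,
      TensorProduct.rid k C (f.lTensor C t) = ∑ g ∈ y.support, f (y g) • (g : C) := by
  suffices h : ∃ y : {g : C // IsGroupLikeElem k g} →₀ C, ∀ f : C →ₗ[k] k,
      TensorProduct.rid k C (f.lTensor C t) =
        Finsupp.linearCombination k Subtype.val (Finsupp.mapRange.linearMap f y) by
    obtain ⟨y, hy⟩ := h
    refine ⟨y, fun f => (hy f).trans ?_⟩
    rw [Finsupp.linearCombination_apply, Finsupp.mapRange.linearMap_apply,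
      Finsupp.sum_mapRange_index (by simp)]
    rfl
  obtain ⟨s, rfl⟩ := mem_range_map_subtype (E := ⊤) ht (fun _ => Submodule.mem_top)
  clear ht
  induction s with
  | zero => exact ⟨0, by simp⟩
  | add x y hx hy =>
    obtain ⟨a, ha⟩ := hx
    obtain ⟨b, hb⟩ := hy
    exact ⟨a + b, fun f => by simp only [map_add, ha, hb]⟩
  | tmul x y =>
    obtain ⟨a, ha⟩ := (Finsupp.mem_span_range_iff_exists_finsupp
      (v := (Subtype.val : {g : C // IsGroupLikeElem k g} → C))).1
      (by rw [range_coe_groupLike]; exact x.2)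
    refine ⟨Finsupp.mapRange.linearMap (LinearMap.toSpanSingleton k C y) a, fun f => ?_⟩
    have h1 : Finsupp.mapRange.linearMap f
        (Finsupp.mapRange.linearMap (LinearMap.toSpanSingleton k C y) a) = f y • a := by
      ext g
      simp [mul_comm]
    rw [h1, map_smul, Finsupp.linearCombination_apply, ha]
    simp

/-- A pointed coalgebra whose skew-primitive elements all lie in the span of the group-like
elements is spanned by its group-like elements. -/
theorem IsPointed.groupLikeSpan_eq_top_of_skewPrimitive (HP : IsPointed k C)
    (H : ∀ g h : C, IsGroupLikeElem k g → IsGroupLikeElem k h →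
      skewPrimitive k g h ≤ groupLikeSpan k C) : groupLikeSpan k C = ⊤ := by
  by_contra hne
  have hnt : Nontrivial (C ⧸ groupLikeSpan k C) := Submodule.Quotient.nontrivial_iff.2 hne
  obtain ⟨σ, hσ⟩ := (rightRegular k C).exists_isHom_of_surjective
    (groupLikeSpan k C).mkQ_surjective fun m hm f => by
      simp only [Submodule.mkQ_apply, Submodule.Quotient.mk_eq_zero] at hm ⊢
      exact groupLikeSpan_act_right_mem f hm
  obtain ⟨m, hm0, h, hh, hm⟩ := HP.exists_act_eq_smul σ
  obtain ⟨x, rfl⟩ := (groupLikeSpan k C).mkQ_surjective m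
  have hx : ∀ f : DualAlg k C,
      (rightRegular k C).act f x - f h • x ∈ groupLikeSpan k C := by
    intro f
    rw [← Submodule.Quotient.mk_eq_zero (groupLikeSpan k C), ← Submodule.mkQ_apply, map_sub, hσ.act,
      hm, map_smul, sub_self]
  -- Modulo the span of the group-likes `x` is an eigenvector of weight `h`, so the first leg of `Δ
  -- x - x ⊗ h` lies in that span.
  obtain ⟨y, hy⟩ := exists_finsupp_of_lTensor_mem_groupLikeSpan
    (t := Coalgebra.comul (R := k) x - x ⊗ₜ[k] h) (fun f => by
      simpa using! hx (WithConv.toConv f))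
  have hact : ∀ f : DualAlg k C, (rightRegular k C).act f x =
      f h • x + ∑ g ∈ y.support, f (y g) • (g : C) := by
    intro f
    rw [← sub_eq_iff_eq_add', ← hy]
    rw [map_sub, map_sub, LinearMap.lTensor_tmul, TensorProduct.rid_tmul]
    rfl
  have hskew : ∀ g ∈ y.support, y g ∈ skewPrimitive k (g : C) h := by
    intro g hg
    refine mem_skewPrimitive_of_mul_apply fun f₁ f₂ => ?_
    -- Both sides of `(f₁ * f₂) ⇀ x = f₁ ⇀ (f₂ ⇀ x)` are expanded by `hact`; the terms in `x`
    -- cancel, and independence of the group-likes allows comparing coefficients.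
    have h1 := RightComodule.act_mul (rightRegular k C) f₁ f₂ x
    rw [hact, hact f₂, map_add, map_smul, hact f₁, map_sum, hh.mul_apply] at h1
    simp only [map_smul, Subtype.prop, IsGroupLikeElem.act_right] at h1
    have h2 : ∑ g ∈ y.support,
        ((f₁ * f₂) (y g) - (f₁ g * f₂ (y g) + f₁ (y g) * f₂ h)) • (g : C) = 0 := by
      simp only [sub_smul, add_smul, Finset.sum_sub_distrib, Finset.sum_add_distrib]
      rw [smul_add, Finset.smul_sum, smul_smul, mul_comm (f₂ h) (f₁ h), add_assoc,
        add_right_inj] at h1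
      simp only [smul_smul] at h1
      simp only [h1, mul_comm (f₂ h), mul_comm (f₁ _) (f₂ (y _))]
      abel
    exact sub_eq_zero.1 (linearIndependent_iff'.1
      (linearIndepOn_isGroupLikeElem (R := k) (A := C)) _ _ h2 g hg)
  refine hm0 ?_
  rw [Submodule.mkQ_apply, Submodule.Quotient.mk_eq_zero]
  -- The counit is applied to the first leg of `Δ x = x ⊗ h + ∑ g ⊗ y_g`.
  have hxs : x = Coalgebra.counit (R := k) x • h + ∑ g ∈ y.support, y g := by
    refine dual_ext fun f : DualAlg k C => ?_
    rw [← counit_act_right, hact]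
    simp only [map_add, map_smul, map_sum, smul_eq_mul, mul_comm (f h)]
    congr 1
    exact Finset.sum_congr rfl fun g _ => by rw [g.2.counit_eq_one, mul_one]
  rw [hxs]
  exact add_mem (Submodule.smul_mem _ _ (Submodule.subset_span hh))
    (sum_mem fun g hg => H g h g.2 hh (hskew g hg))

theorem IsPointed.groupLikeSpan_eq_top_of_isDiscrete (HP : IsPointed k C) {V : Type*}
    [Quiver V] (HV : IsGabrielQuiver k C V) (H : IsDiscrete V) : groupLikeSpan k C = ⊤ := by
  obtain ⟨e, he⟩ := HV
  refine HP.groupLikeSpan_eq_top_of_skewPrimitive fun g h hg hh x hx => ?_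
  obtain ⟨a, ha⟩ := e.surjective ⟨g, hg⟩
  obtain ⟨b, hb⟩ := e.surjective ⟨h, hh⟩
  obtain rfl : (e a : C) = g := congrArg Subtype.val ha
  obtain rfl : (e b : C) = h := congrArg Subtype.val hb
  obtain ⟨B⟩ := he a b
  have := H a b
  have h0 := B.repr.injective
    (Subsingleton.elim (B.repr (Submodule.Quotient.mk ⟨x, hx⟩)) (B.repr 0))
  rw [Submodule.Quotient.mk_eq_zero] at h0
  have h1 : x ∈ k ∙ ((e a : C) - (e b : C)) := h0
  exact (Submodule.span_singleton_le_iff_mem _ _).2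
    (sub_mem (Submodule.subset_span hg) (Submodule.subset_span hh)) h1

theorem IsGabrielQuiver.isDiscrete {V : Type*} [Quiver V] (HV : IsGabrielQuiver k C V)
    (H : ∀ g h : C, IsGroupLikeElem k g → IsGroupLikeElem k h →
      skewPrimitive k g h ≤ k ∙ (g - h)) : IsDiscrete V := by
  obtain ⟨e, he⟩ := HV
  refine fun a b => ⟨fun α => ?_⟩
  obtain ⟨B⟩ := he a b
  refine B.ne_zero α ?_
  obtain ⟨x, hx⟩ := Submodule.Quotient.mk_surjective _ (B α)
  rw [← hx, Submodule.Quotient.mk_eq_zero]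
  exact H _ _ (e a).2 (e b).2 x.2

end Pointed

/-! ### Path coalgebras -/

section Path

variable {k : Type u} [Field k] {V : Type v} [Quiver.{w} V]

theorem comul_ofPath {a b : V} (p : Quiver.Path a b) :
    Coalgebra.comul (R := k) (ofPath k p) =
      ((splits p).map fun s => ofPath k s.2.1 ⊗ₜ[k] ofPath k s.2.2).sum :=
  pathComul_ofPath k p

variable (k) in
theorem isGroupLikeElem_ofPath_nil (a : V) :
    IsGroupLikeElem k (ofPath k (Quiver.Path.nil : Quiver.Path a a)) where
  counit_eq_one := (pathCounit_ofPath k _).trans (if_pos rfl)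
  comul_eq_tmul_self := (comul_ofPath _).trans (by simp [splits])

theorem splits_toPath_comp {a b c : V} (α : a ⟶ b) (y : Quiver.Path b c) :
    splits (α.toPath.comp y) =
      (splits y).map (fun s => ⟨s.1, α.toPath.comp s.2.1, s.2.2⟩) ++
        [⟨a, .nil, α.toPath.comp y⟩] := by
  induction y with
  | nil => simp [splits, Quiver.Hom.toPath]
  | cons y β ih => simp [splits, ih, Function.comp_def]

variable {C : Type u'} [AddCommGroup C] [Module k C] [Coalgebra k C]
  (e : C ≃ₗc[k] PathCoalgebra k V)

/-- The element given by a path in a coalgebra isomorphic to the path coalgebra. -/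
noncomputable def pathElem {a b : V} (p : Quiver.Path a b) : C := e.symm (ofPath k p)

/-- The functional with prescribed values on the paths. -/
noncomputable def pathFunctional (φ : AllPaths V → k) : DualAlg k C :=
  WithConv.toConv ((show PathCoalgebra k V →ₗ[k] k from Finsupp.linearCombination k φ) ∘ₗ
    e.toCoalgHom.toLinearMap)

theorem pathFunctional_pathElem (φ : AllPaths V → k) {a b : V} (p : Quiver.Path a b) :
    pathFunctional e φ (pathElem e p) = φ ⟨a, b, p⟩ := by
  change (show PathCoalgebra k V →ₗ[k] k from Finsupp.linearCombination k φ)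
    (e (e.symm (ofPath k p))) = _
  rw [CoalgEquiv.apply_symm_apply]
  exact (Finsupp.linearCombination_single k _ _).trans (one_smul k _)

theorem isGroupLikeElem_pathElem_nil (a : V) :
    IsGroupLikeElem k (pathElem e (Quiver.Path.nil : Quiver.Path a a)) :=
  (isGroupLikeElem_ofPath_nil k a).map e.symm

theorem comul_pathElem {a b : V} (p : Quiver.Path a b) :
    Coalgebra.comul (R := k) (pathElem e p) =
      ((splits p).map fun s => pathElem e s.2.1 ⊗ₜ[k] pathElem e s.2.2).sum := by
  rw [pathElem, ← CoalgHomClass.map_comp_comul_apply, comul_ofPath, map_list_sum, List.map_map]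
  rfl

theorem mul_apply_pathElem (f₁ f₂ : DualAlg k C) {a b : V} (p : Quiver.Path a b) :
    (f₁ * f₂) (pathElem e p) =
      ((splits p).map fun s => f₁ (pathElem e s.2.1) * f₂ (pathElem e s.2.2)).sum := by
  rw [LinearMap.convMul_apply, comul_pathElem, map_list_sum, map_list_sum, List.map_map,
    List.map_map]
  rfl

theorem span_pathElem : Submodule.span k (Set.range fun p : AllPaths V => pathElem e p.2.2) = ⊤ := by
  refine eq_top_iff.2 fun c _ => ?_
  have h : ∀ x : PathCoalgebra k V,
      e.symm x ∈ Submodule.span k (Set.range fun p : AllPaths V => pathElem e p.2.2) := by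
    intro x
    refine Finsupp.induction_linear (motive := fun x : AllPaths V →₀ k =>
      e.symm (show PathCoalgebra k V from x) ∈ _) x ?_ (fun x y hx hy => ?_) fun p a => ?_
    · exact (map_zero e.symm).symm ▸ zero_mem _
    · exact (map_add e.symm x y).symm ▸ add_mem hx hy
    · have h1 : (show PathCoalgebra k V from Finsupp.single p a) = a • ofPath k p.2.2 :=
        (Finsupp.smul_single_one p a).symm
      rw [h1, map_smul]
      exact Submodule.smul_mem _ _ (Submodule.subset_span ⟨p, rfl⟩)
  simpa using h (e c)

theorem eq_zero_of_pathElem {φ : DualAlg k C}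
    (h : ∀ (a b : V) (p : Quiver.Path a b), φ (pathElem e p) = 0) : φ = 0 := by
  refine WithConv.ext (LinearMap.ext_on (span_pathElem e) ?_)
  rintro _ ⟨p, rfl⟩
  exact h _ _ _

include e in
theorem IsLeftFQcF.isDiscrete_of_pathCoalgebra (H : IsLeftFQcF k C) : IsDiscrete V := by
  classical
  refine fun a b => ⟨fun α => ?_⟩
  obtain ⟨φ, hφ, hm⟩ := H.exists_mul_eq (isGroupLikeElem_pathElem_nil e b)
  refine hφ (eq_zero_of_pathElem e fun b' c y => ?_)
  by_cases hb : b' = b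
  · subst hb
    -- The indicator of length one vanishes at the vertex `b`, so its product with `φ` is zero. At
    -- the path `α y` the only factorisation with initial factor of length one is `(α, y)`, hence `φ
    -- y = 0`.
    have h1 := hm (pathFunctional e fun p => if p.2.2.length = 1 then 1 else 0)
    rw [pathFunctional_pathElem] at h1
    simp only [Quiver.Path.length_nil, zero_ne_one, if_false, zero_smul] at h1
    have h2 := congrArg (fun ψ : DualAlg k C => ψ (pathElem e (α.toPath.comp y))) h1
    simp only [mul_apply_pathElem, splits_toPath_comp, pathFunctional_pathElem,
      List.map_append, List.map_map, Function.comp_def] at h2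
    have h3 := splits_counit_left k y fun _ z => φ (pathElem e z)
    simpa [← h3, add_comm 1] using h2
  -- The indicator of paths starting at `b` fixes `φ`, but it vanishes on all initial factors of
  -- `y`, which start at `b'`.
  · have h1 := hm (pathFunctional e fun p => if p.1 = b then 1 else 0)
    rw [pathFunctional_pathElem] at h1
    have h2 := congrArg (fun ψ : DualAlg k C => ψ (pathElem e y)) h1
    simp only [mul_apply_pathElem, pathFunctional_pathElem, if_neg hb] at h2
    simpa using h2.symm

include e in
theorem IsRightFQcF.isDiscrete_of_pathCoalgebra (H : IsRightFQcF k C) : IsDiscrete V := by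
  classical
  refine fun a b => ⟨fun α => ?_⟩
  obtain ⟨φ, hφ, hm⟩ := H.exists_mul_eq (isGroupLikeElem_pathElem_nil e a)
  refine hφ (eq_zero_of_pathElem e fun c a' y => ?_)
  by_cases ha : a' = a
  · subst ha
    -- As in the left case, with the arrow appended: the only factorisation of `y α` whose final
    -- factor has length one is `(y, α)`.
    have h1 := hm (pathFunctional e fun p => if p.2.2.length = 1 then 1 else 0)
    rw [pathFunctional_pathElem] at h1
    simp only [Quiver.Path.length_nil, zero_ne_one, if_false, zero_smul] at h1
    have h2 := congrArg (fun ψ : DualAlg k C => ψ (pathElem e (y.cons α))) h1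
    simp only [mul_apply_pathElem, splits, pathFunctional_pathElem,
      List.map_cons, List.sum_cons, List.map_map, Function.comp_def] at h2
    have h3 := splits_counit_right k y fun _ z => φ (pathElem e z)
    simpa [← h3, mul_comm] using h2
  · have h1 := hm (pathFunctional e fun p => if p.2.1 = a then 1 else 0)
    rw [pathFunctional_pathElem] at h1
    have h2 := congrArg (fun ψ : DualAlg k C => ψ (pathElem e y)) h1
    simp only [mul_apply_pathElem, pathFunctional_pathElem, if_neg ha] at h2
    simpa using h2.symm

include e in
theorem groupLikeSpan_eq_top_of_isDiscrete (H : IsDiscrete V) : groupLikeSpan k C = ⊤ := by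
  rw [← top_le_iff, ← span_pathElem e, Submodule.span_le]
  rintro _ ⟨⟨a, b, p⟩, rfl⟩
  cases p with
  | nil => exact Submodule.subset_span (isGroupLikeElem_pathElem_nil e a)
  | cons p α => exact (H _ _).elim α

theorem act_right_pathElem (f : DualAlg k C) {a b : V} (p : Quiver.Path a b) :
    (rightRegular k C).act f (pathElem e p) =
      ((splits p).map fun s => f (pathElem e s.2.2) • pathElem e s.2.1).sum := by
  change TensorProduct.rid k C (f.ofConv.lTensor C (Coalgebra.comul (R := k) (pathElem e p))) = _
  rw [comul_pathElem, map_list_sum, map_list_sum, List.map_map, List.map_map]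
  simp [Function.comp_def]

/-- Every nonzero subcoalgebra of a path coalgebra contains a vertex. -/
theorem IsSubcoalgebra.exists_pathElem_nil_mem {D : Submodule k C} (hD : IsSubcoalgebra k D)
    (h0 : D ≠ ⊥) : ∃ a : V, pathElem e (Quiver.Path.nil : Quiver.Path a a) ∈ D := by
  classical
  obtain ⟨x, hx, hx0⟩ := D.ne_bot_iff.1 h0
  let c : AllPaths V →₀ k := e x
  have hc0 : c ≠ 0 := fun h => hx0 (e.injective (h.trans (map_zero e).symm))
  -- Acting by the indicator of `p` strips a final factor `p`. By maximality of its length no other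
  -- path in the support ends in `p`, so only a multiple of the source vertex of `p` survives.
  obtain ⟨p, hp, hmax⟩ := c.support.exists_max_image (fun p => p.2.2.length)
    (Finsupp.support_nonempty_iff.2 hc0)
  have hxc : x = ∑ q ∈ c.support, c q • pathElem e q.2.2 := by
    refine e.injective (?_ : e x = e (∑ q ∈ c.support, c q • pathElem e q.2.2))
    simp only [map_sum, map_smul, pathElem, CoalgEquiv.apply_symm_apply]
    refine (Finsupp.sum_single c).symm.trans (Finset.sum_congr rfl fun q _ => ?_)
    exact (Finsupp.smul_single_one q (c q)).symm
  let f : DualAlg k C := pathFunctional e fun q => if q = p then 1 else 0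
  have hact : ∀ q ∈ c.support, (rightRegular k C).act f (pathElem e q.2.2) =
      if q = p then pathElem e (Quiver.Path.nil : Quiver.Path p.1 p.1) else 0 := by
    rintro ⟨a, b, q⟩ hq
    have hlen : q.length ≤ p.2.2.length := hmax _ hq
    rw [act_right_pathElem]
    -- A factorisation with nontrivial initial part has final factor shorter than `p`, so the sum
    -- may be weighted by the counit of the initial part, and it collapses.
    have h1 := splits_counit_left k q fun d y =>
      f (pathElem e y) • pathElem e (Quiver.Path.nil : Quiver.Path d d)
    have h2 : ∀ s ∈ splits q, f (pathElem e s.2.2) • pathElem e s.2.1 =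
        (if s.2.1.length = 0 then (1 : k) else 0) •
          f (pathElem e s.2.2) • pathElem e (Quiver.Path.nil : Quiver.Path s.1 s.1) := by
      rintro ⟨d, y, z⟩ hs
      have hyz : y.length + z.length = q.length := by
        rw [← Quiver.Path.length_comp, (mem_splits q _).1 hs]
      cases y with
      | nil => simp
      | cons y α =>
        have hz : (⟨d, b, z⟩ : AllPaths V) ≠ p := by
          rintro rfl
          simp at hyz hlen
          omega
        simp [f, pathFunctional_pathElem, hz]
    rw [List.map_congr_left h2, h1]
    simp only [f, pathFunctional_pathElem]
    split_ifs with hqp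
    · subst hqp
      simp
    · simp
  refine ⟨p.1, ?_⟩
  have hmem := hD.act_right_mem f hx
  rw [hxc, map_sum] at hmem
  simp only [map_smul] at hmem
  rw [Finset.sum_congr rfl fun q hq => by rw [hact q hq]] at hmem
  simp only [smul_ite, smul_zero, Finset.sum_ite_eq', if_pos hp] at hmem
  exact (D.smul_mem_iff (Finsupp.mem_support_iff.1 hp)).1 hmem

include e in
theorem isPointed_of_pathCoalgebra : IsPointed k C := by
  intro D hD
  obtain ⟨a, ha⟩ := hD.1.exists_pathElem_nil_mem e hD.2.1
  have hg := isGroupLikeElem_pathElem_nil e a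
  obtain h | h := hD.2.2 _ hg.isSimpleSubcoalgebra.1
    ((Submodule.span_singleton_le_iff_mem _ _).2 ha)
  · exact absurd h hg.isSimpleSubcoalgebra.2.1
  · rw [← h, finrank_span_singleton hg.ne_zero]

end Path

/-- The quasi-coFrobenius conditions on a pointed coalgebra are equivalent if the one-sided
f-qcF conditions each force the quiver to be discrete. -/
theorem IsPointed.tfae {k : Type u} [Field k] {C : Type u'} [AddCommGroup C] [Module k C]
    [Coalgebra k C] {V : Type v} [Quiver.{w} V] (HP : IsPointed k C)
    (hl : IsLeftFQcF k C → IsDiscrete V) (hr : IsRightFQcF k C → IsDiscrete V)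
    (hd : IsDiscrete V → groupLikeSpan k C = ⊤) :
    List.TFAE [
      IsLeftFQcF k C,
      IsRightFQcF k C,
      IsLeftQcF k C,
      IsRightQcF k C,
      IsCoFrobenius k C,
      IsLeftCoFrobenius k C,
      IsRightCoFrobenius k C,
      IsCosemisimple k C,
      IsDiscrete V] := by
  tfae_have 1 → 9 := hl
  tfae_have 2 → 9 := hr
  tfae_have 3 → 1 := IsLeftQcF.isLeftFQcF
  tfae_have 4 → 2 := IsRightQcF.isRightFQcF
  tfae_have 6 → 3 := IsLeftCoFrobenius.isLeftQcF
  tfae_have 7 → 4 := IsRightCoFrobenius.isRightQcF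
  tfae_have 6 → 5 := Or.inl
  tfae_have 5 → 9 := fun h => h.elim (fun h => hl h.isLeftQcF.isLeftFQcF)
    fun h => hr h.isRightQcF.isRightFQcF
  tfae_have 9 → 8 := fun h => isCosemisimple_of_groupLikeSpan_eq_top (hd h)
  tfae_have 8 → 6 := fun h => isLeftCoFrobenius_of_groupLikeSpan_eq_top (HP.groupLikeSpan_eq_top h)
  tfae_have 8 → 7 := fun h => isRightCoFrobenius_of_groupLikeSpan_eq_top (HP.groupLikeSpan_eq_top h)
  tfae_finish

end QcF

theorem mainTheorem5 {k : Type u} [Field k] :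
    (∀ (C : Type u) [AddCommGroup C] [Module k C] [Coalgebra k C]
        (V : Type v) [Quiver.{w} V],
      QcF.IsPointed k C → QcF.IsHereditary k C → QcF.IsGabrielQuiver k C V →
      List.TFAE [
        QcF.IsLeftFQcF k C,
        QcF.IsRightFQcF k C,
        QcF.IsLeftQcF k C,
        QcF.IsRightQcF k C,
        QcF.IsCoFrobenius k C,
        QcF.IsLeftCoFrobenius k C,
        QcF.IsRightCoFrobenius k C,
        QcF.IsCosemisimple k C,
        QcF.IsDiscrete V]) ∧
    (∀ (C : Type u') [AddCommGroup C] [Module k C] [Coalgebra k C]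
        (V : Type v) [Quiver.{w} V],
      Nonempty (C ≃ₗc[k] QcF.PathCoalgebra k V) →
      List.TFAE [
        QcF.IsLeftFQcF k C,
        QcF.IsRightFQcF k C,
        QcF.IsLeftQcF k C,
        QcF.IsRightQcF k C,
        QcF.IsCoFrobenius k C,
        QcF.IsLeftCoFrobenius k C,
        QcF.IsRightCoFrobenius k C,
        QcF.IsCosemisimple k C,
        QcF.IsDiscrete V]) := by
  refine ⟨fun C _ _ _ V _ HP HH HV => ?_, fun C _ _ _ V _ ⟨e⟩ => ?_⟩
  · exact HP.tfae
      (fun h => HV.isDiscrete fun _ _ hg hh _ hx => HH.mem_span_sub_of_isLeftFQcF h hg hh hx)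
      (fun h => HV.isDiscrete fun _ _ hg hh _ hx => HH.mem_span_sub_of_isRightFQcF h hg hh hx)
      (HP.groupLikeSpan_eq_top_of_isDiscrete HV)
  · exact (QcF.isPointed_of_pathCoalgebra e).tfae
      (QcF.IsLeftFQcF.isDiscrete_of_pathCoalgebra e)
      (QcF.IsRightFQcF.isDiscrete_of_pathCoalgebra e)
      (QcF.groupLikeSpan_eq_top_of_isDiscrete e)
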